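/- Let $k$ be an algebraically closed field of characteristic $p>0$, let $X'$ be a (possibly singular) integral proper curve over $k$, and let $\pi\colon X\to X'$ be its normalization, so that $X$ is a non-singular integral proper curve over $k$. Let $\Omega_{k(X)/k}$ be the space of rational differential forms on $X$, and let $\mathscr C\colon \Omega_{k(X)/k}\to\Omega_{k(X)/k}$ be the Cartier operator, i.e. $\mathscr C(a^p x^{p-1}\,dx+dh)=a\,dx$ for $a,x,h\in k(X)$. Let $\Omega_{X'}$ be the sheaf of regular (Rosenlicht) differentials on $X'$: its sections over an open set $U\ne\emptyset$ are the forms $\omega\in\Omega_{k(X)/k}$ such that $$\sum_{x\in\pi^{-1}(x')}\operatorname{Res}_x(f\omega)=0\qquad\text{for every closed point }x'\in U\text{ and every } f\in\mathcal O_{X',x'} .$$ Let $F\colon H^1(X',\mathcal O_{X'})\to H^1(X',\mathcal O_{X'})$ be the Frobenius map, induced by $f\mapsto f^p$ on $\mathcal O_{X'}$, and let $$\langle\ ,\ \rangle\colon H^1(X',\mathcal O_{X'})\times H^0(X',\Omega_{X'})\to H^1(X',\Omega_{X'})\to k$$ be the duality pairing, i.e. the cup product followed by the residue map. (The residue map $H^1(X',\Omega_{X'})\to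 k$ is the one induced, via the connecting homomorphism of $0\to\Omega_{X'}\to\Omega_{k(X)/k}\to\Omega_{k(X)/k}/\Omega_{X'}\to0$ with $\Omega_{k(X)/k}$ regarded as a constant sheaf, by $(\omega_{x'})_{x'}\mapsto\sum_{x'}\sum_{x\mapsto x'}\operatorname{Res}_x(\omega_{x'})$.) Then: a) $\mathscr C(H^0(X',\Omega_{X'}))\subset H^0(X',\Omega_{X'})$; b) $\langle Fv,\omega\rangle=\langle v,\mathscr C\omega\rangle^{p}$ for all $v\in H^1(X',\mathcal O_{X'})$ and $\omega\in H^0(X',\Omega_{X'})$. -/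

import Mathlib

open CategoryTheory TopologicalSpace Opposite AlgebraicGeometry

universe u

noncomputable section

namespace CartierRosenlicht

/-! ## Sheaves of locally constant functions with pointwise conditions -/

/-- Constant functions on open sets whose value at each point `x` lies in `L x`. -/
def constPrelocal {X : TopCat.{u}} {M : Type u} [AddCommGroup M] (L : X → AddSubgroup M) :
    TopCat.PrelocalPredicate (fun _ : X => M) where
  pred {U} s := ∃ m : M, ∀ x : U, s x = m ∧ m ∈ L x.1
  res i _ := fun ⟨m, hm⟩ => ⟨m, fun x => hm (i x)⟩

/-- The sections on `U`: the functions `s : U → M` that are locally constant with locally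
constant value `m` satisfying `m ∈ L x` at all points `x`. -/
def constSections {X : TopCat.{u}} {M : Type u} [AddCommGroup M] (L : X → AddSubgroup M)
    (U : Opens X) : AddSubgroup (U → M) where
  carrier := {s | (constPrelocal L).sheafify.pred s}
  zero_mem' := fun x => ⟨U, x.2, 𝟙 _, 0, fun y => ⟨rfl, (L y.1).zero_mem⟩⟩
  add_mem' hs ht := (constPrelocal L).sheafify_inductionOn₂' (constPrelocal L)
    (constPrelocal L) (fun {_} a b => a + b)
    (fun ⟨m, hm⟩ ⟨n, hn⟩ => ⟨m + n, fun x =>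
      ⟨congrArg₂ (· + ·) (hm ⟨x.1, x.2.1⟩).1 (hn ⟨x.1, x.2.2⟩).1,
        (L x.1).add_mem (hm ⟨x.1, x.2.1⟩).2 (hn ⟨x.1, x.2.2⟩).2⟩⟩) hs ht
  neg_mem' hs := (constPrelocal L).sheafify_inductionOn' (fun {_} a => -a)
    (fun ⟨m, hm⟩ => ⟨-m, fun x => ⟨congrArg (- ·) (hm x).1, (L x.1).neg_mem (hm x).2⟩⟩) hs

/-- The presheaf `U ↦ constSections L U` of abelian groups. -/
def constPresheaf {X : TopCat.{u}} {M : Type u} [AddCommGroup M] (L : X → AddSubgroup M) :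
    (Opens X)ᵒᵖ ⥤ AddCommGrpCat.{u} where
  obj U := AddCommGrpCat.of (constSections L U.unop)
  map i := AddCommGrpCat.ofHom
    { toFun := fun s => ⟨fun x => s.1 (i.unop x),
        (constPrelocal L).sheafify.res i.unop s.1 s.2⟩
      map_zero' := rfl
      map_add' := fun _ _ => rfl }

/-- The sheaf of abelian groups `U ↦ constSections L U`. For `L x = M` for all `x` it is the
constant sheaf `M`; in general it is the subsheaf of the constant sheaf `M` cut out by the
conditions `L x`. -/
def constSheaf {X : TopCat.{u}} {M : Type u} [AddCommGroup M] (L : X → AddSubgroup M) :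
    Sheaf (Opens.grothendieckTopology X) AddCommGrpCat.{u} where
  obj := constPresheaf L
  property := by
    refine (TopCat.Presheaf.isSheaf_iff_isSheaf_comp (forget AddCommGrpCat)
      (constPresheaf L)).mpr ?_
    exact TopCat.Presheaf.isSheaf_of_iso
      (NatIso.ofComponents (fun _ => Iso.refl _))
      (TopCat.subpresheafToTypes.isSheaf (constPrelocal L).sheafify)

/-- The inclusion of sheaves induced by `L ≤ L'`. -/
def constSheafIncl {X : TopCat.{u}} {M : Type u} [AddCommGroup M] {L L' : X → AddSubgroup M}
    (h : ∀ x, L x ≤ L' x) : constSheaf L ⟶ constSheaf L' where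
  hom :=
    { app := fun U => AddCommGrpCat.ofHom
        { toFun := fun s => ⟨s.1, fun x => by
            obtain ⟨V, hV, i, m, hm⟩ := s.2 x
            exact ⟨V, hV, i, m, fun y => ⟨(hm y).1, h _ (hm y).2⟩⟩⟩
          map_zero' := rfl
          map_add' := fun _ _ => rfl } }

instance constSheafIncl_mono {X : TopCat.{u}} {M : Type u} [AddCommGroup M]
    {L L' : X → AddSubgroup M} (h : ∀ x, L x ≤ L' x) : Mono (constSheafIncl h) := by
  have : ∀ U, Mono ((constSheafIncl h).hom.app U) := fun U => by
    rw [AddCommGrpCat.mono_iff_injective]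
    intro a b hab
    exact Subtype.ext (congrArg Subtype.val hab :)
  have : Mono (constSheafIncl h).hom := NatTrans.mono_of_mono_app _
  exact Sheaf.Hom.mono_of_presheaf_mono _ _ _

/-- The constant section with value `m` of the constant sheaf `M` on `U`. -/
def constSection {X : TopCat.{u}} {M : Type u} [AddCommGroup M] (U : Opens X) (m : M) :
    (constSheaf (fun _ : X => (⊤ : AddSubgroup M))).obj.obj (op U) :=
  (⟨fun _ => m, fun x => ⟨U, x.2, 𝟙 _, m, fun _ => ⟨rfl, trivial⟩⟩⟩ :
    constSections (fun _ : X => (⊤ : AddSubgroup M)) U)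

/-- The exact sequence `0 → 𝓛 → M → M/𝓛 → 0` of sheaves of abelian groups, where `M` is the
constant sheaf and `𝓛 = constSheaf L`. -/
def quotientSequence {X : TopCat.{u}} {M : Type u} [AddCommGroup M] (L : X → AddSubgroup M) :
    ShortComplex (Sheaf (Opens.grothendieckTopology X) AddCommGrpCat.{u}) :=
  ShortComplex.mk (constSheafIncl (L := L) (L' := fun _ => ⊤) (fun _ => le_top))
    (Limits.cokernel.π _) (Limits.cokernel.condition _)

lemma quotientSequence_shortExact {X : TopCat.{u}} {M : Type u} [AddCommGroup M]
    (L : X → AddSubgroup M) : (quotientSequence L).ShortExact where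
  exact := ShortComplex.exact_cokernel _
  mono_f := constSheafIncl_mono (fun _ => le_top)
  epi_g := by unfold quotientSequence; infer_instance

/-- The connecting homomorphism `H⁰(X, M/𝓛) → H¹(X, 𝓛)`. -/
def connecting {X : TopCat.{u}} {M : Type u} [AddCommGroup M] (L : X → AddSubgroup M)
    (s : (quotientSequence L).X₃.obj.obj (op ⊤)) : (constSheaf L).H 1 :=
  ((Sheaf.H.equiv₀ (quotientSequence L).X₃ Limits.isTerminalTop).symm s).comp
    (quotientSequence_shortExact L).extClass (zero_add 1)

/-- The family `r : X → M` represents the global section `s` of `M/𝓛` if near every point `x`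
the section `s` is the class of the constant section `r x` of `M`. -/
def Represents {X : TopCat.{u}} {M : Type u} [AddCommGroup M] (L : X → AddSubgroup M)
    (s : (quotientSequence L).X₃.obj.obj (op ⊤)) (r : X → M) : Prop :=
  ∀ x : X, ∃ U : Opens X, x ∈ U ∧
    (quotientSequence L).X₃.obj.map (homOfLE (le_top : U ≤ ⊤)).op s =
      (quotientSequence L).g.hom.app (op U) (constSection U (r x))

/-! ## Residues and the Cartier operator on differentials of a function field -/

section Field

open KaehlerDifferential

/-- The residue functional `Ω_{K/k} → k` at a discrete valuation ring `R` of `K/k` with residue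
field `k` and uniformizer `t`: the `k`-linear functional which maps
`ω = (a_m t^{-m-1} + ⋯ + a_1 t^{-2} + a_0 t^{-1} + g) dt`, with `a_i ∈ k` and `g ∈ R`,
to the coefficient `a_0` of `t^{-1} dt`. -/
def residueAlong (k : Type u) [Field k] (R K : Type u) [CommRing R] [Field K] [Algebra k K]
    [Algebra R K] (t : R) : Ω[K⁄k] →ₗ[k] k :=
  open Classical in
  if h : ∃ ρ : Ω[K⁄k] →ₗ[k] k, ∀ (m : ℕ) (a : ℕ → k) (g : R),
      ρ ((∑ i ∈ Finset.range (m + 1), algebraMap k K (a i) * ((algebraMap R K t)⁻¹) ^ (i + 1) +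
        algebraMap R K g) • D k K (algebraMap R K t)) = a 0
  then h.choose else 0

/-- The residue functional at `R`, computed with a uniformizer (the result does not depend on it).
If `R` has no uniformizer, for example if `R = K`, it is `0`. -/
def residue (k : Type u) [Field k] (R K : Type u) [CommRing R] [Field K] [Algebra k K]
    [Algebra R K] : Ω[K⁄k] →ₗ[k] k :=
  open Classical in
  if h : ∃ t : R, Irreducible t then residueAlong k R K h.choose else 0

/-- `η` is the image of `ω` under the Cartier operator, that is, `C⁻¹ η = ω` modulo exact forms,
where `C⁻¹ (a dx) = a ^ p x ^ (p - 1) dx`. -/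
def IsCartierImage {k : Type u} [Field k] {K : Type u} [Field K] [Algebra k K] (p : ℕ)
    (ω η : Ω[K⁄k]) : Prop :=
  ∃ a x h : K, ω = (a ^ p * x ^ (p - 1)) • D k K x + D k K h ∧ η = a • D k K x

/-- The Cartier operator on the differentials of a function field `K` in one variable over
a perfect field `k` of characteristic `p`: `C (a ^ p x ^ (p - 1) dx + dh) = a dx`. -/
def cartier {k : Type u} [Field k] {K : Type u} [Field K] [Algebra k K] (p : ℕ)
    (ω : Ω[K⁄k]) : Ω[K⁄k] :=
  open Classical in
  if h : ∃ η, IsCartierImage p ω η then h.choose else 0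

end Field

/-! ## Function fields and normalization -/

/-- The function field of an integral scheme `X` over `k`, as a `k`-algebra. -/
def FunctionField {k : Type u} [Field k] {X : Scheme.{u}} [IsIntegral X]
    (_s : X ⟶ Spec (.of k)) : Type u := X.functionField

section

variable {k : Type u} [Field k] {X : Scheme.{u}} [IsIntegral X] (s : X ⟶ Spec (.of k))

instance : Field (FunctionField s) := inferInstanceAs (Field X.functionField)

/-- The structure map of `Γ(X, U)` as a `k`-algebra. -/
def scalars {k : Type u} [Field k] {X : Scheme.{u}} (s : X ⟶ Spec (.of k)) (U : X.Opens) :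
    k →+* Γ(X, U) :=
  ((Scheme.ΓSpecIso (.of k)).inv ≫ s.appTop ≫
    X.presheaf.map (homOfLE (le_top : U ≤ ⊤)).op).hom

instance : Algebra k (FunctionField s) :=
  ((X.presheaf.germ ⊤ (genericPoint X) trivial).hom.comp (scalars s ⊤)).toAlgebra

instance (y : X) : Algebra (X.presheaf.stalk y) (FunctionField s) :=
  inferInstanceAs (Algebra (X.presheaf.stalk y) X.functionField)

end

/-- `π : X → X'` is the normalization of the integral scheme `X'`: `X` is integral and normal,
and `π` is integral and birational. -/
class IsNormalization {X X' : Scheme.{u}} [IsIntegral X] (π : X ⟶ X') : Prop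
    extends IsIntegralHom π, IsDominant π where
  normal : ∀ x : X, IsIntegrallyClosed (X.presheaf.stalk x)
  birational : IsIso (π.stalkMap (genericPoint X))

section Curve

variable {k : Type u} [Field k] {X X' : Scheme.{u}} [IsIntegral X]
  (s : X' ⟶ Spec (.of k)) (π : X ⟶ X')

lemma specializes_of_isDominant {X X' : Scheme.{u}} [IsIntegral X] (π : X ⟶ X') [IsDominant π]
    (x : X') : π (genericPoint X) ⤳ x := by
  rw [specializes_iff_mem_closure]
  have h : Set.range π ⊆ closure {π (genericPoint X)} := by
    rintro _ ⟨y, rfl⟩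
    exact specializes_iff_mem_closure.mp
      (((genericPoint_spec X).specializes trivial).map π.continuous)
  have h2 := closure_minimal h isClosed_closure
  rw [π.denseRange.closure_range] at h2
  exact h2 trivial

/-- The pullback `𝒪_{X', x} → K(X)` along the dominant morphism `π : X → X'`. -/
def stalkPullback [IsDominant π] (x : X') :
    X'.presheaf.stalk x →+* FunctionField (π ≫ s) :=
  (X'.presheaf.stalkSpecializes (specializes_of_isDominant π x) ≫
    π.stalkMap (genericPoint X)).hom

open KaehlerDifferential in
/-- `∑_{y ↦ x} Res_y`, the sum being over all points `y` of `X` above the point `x` of `X'`.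
It is `0` if `x` is the generic point, since then the local ring at `y` is a field. -/
def fibreResidue (x : X') : Ω[FunctionField (π ≫ s)⁄k] →ₗ[k] k :=
  ∑ᶠ (y : X) (_ : π y = x), residue k (X.presheaf.stalk y) (FunctionField (π ≫ s))

open KaehlerDifferential in
/-- The stalk at `x` of the sheaf `Ω_{X'}` of regular (Rosenlicht) differentials: the rational
forms `ω` on `X` with `∑_{y ↦ x} Res_y (f ω) = 0` for all `f ∈ 𝒪_{X', x}`. -/
def regularAt [IsDominant π] (x : X') : Submodule k (Ω[FunctionField (π ≫ s)⁄k]) where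
  carrier := {ω | ∀ f : X'.presheaf.stalk x,
    fibreResidue s π x (stalkPullback s π x f • ω) = 0}
  zero_mem' := fun f => by simp
  add_mem' ha hb := fun f => by rw [smul_add, map_add, ha f, hb f, add_zero]
  smul_mem' c ω h := fun f => by rw [smul_comm, map_smul, h f, smul_zero]

open KaehlerDifferential in
/-- The space `H⁰(X', Ω_{X'})` of global regular differentials, inside the rational forms
on `X`. -/
def regularDifferentials [IsDominant π] : Submodule k (Ω[FunctionField (π ≫ s)⁄k]) :=
  ⨅ x : X', regularAt s π x

open KaehlerDifferential in
/-- The stalks of the sheaf `Ω_{X'}` as additive subgroups of the rational forms on `X`. -/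
def regularStalk [IsDominant π] (x : X'.toTopCat) :
    AddSubgroup (Ω[FunctionField (π ≫ s)⁄k]) :=
  (regularAt s π x).toAddSubgroup

/-- The sheaf `Ω_{X'}` of regular differentials on `X'`, a subsheaf of the constant sheaf of
rational forms. -/
def regularSheaf [IsDominant π] :
    Sheaf (Opens.grothendieckTopology X') AddCommGrpCat.{u} :=
  constSheaf (regularStalk s π)

/-- The structure sheaf as a sheaf of abelian groups. -/
def structureSheafAb (X' : Scheme.{u}) : Sheaf (Opens.grothendieckTopology X') AddCommGrpCat.{u} :=
  (sheafCompose (Opens.grothendieckTopology X')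
    (forget₂ CommRingCat.{u} RingCat.{u} ⋙ forget₂ RingCat.{u} AddCommGrpCat.{u})).obj
      ⟨X'.presheaf, X'.sheaf.property⟩

/-- The Frobenius endomorphism `f ↦ f ^ p` of the structure sheaf. -/
def frobeniusSheaf {k : Type u} [Field k] {X' : Scheme.{u}} (s : X' ⟶ Spec (.of k)) (p : ℕ) [Fact p.Prime] [CharP k p] :
    structureSheafAb X' ⟶ structureSheafAb X' where
  hom :=
    { app := fun U => AddCommGrpCat.ofHom
        ((AddMonoidHom.mk' (fun f : Γ(X', U.unop) => f ^ p) fun f g => by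
          obtain ⟨r, hr⟩ := exists_add_pow_prime_eq (Fact.out : p.Prime) f g
          have h0 : (p : Γ(X', U.unop)) = 0 := by
            rw [← map_natCast (scalars s U.unop) p, CharP.cast_eq_zero, map_zero]
          rw [hr, h0]; simp) : Γ(X', U.unop) →+ Γ(X', U.unop))
      naturality := fun U V i => by
        ext f
        have h : ∀ f : Γ(X', U.unop), ((X'.presheaf.map i).hom f) ^ p =
          (X'.presheaf.map i).hom (f ^ p) := fun f => (map_pow _ f p).symm
        exact h f }

/-- The Frobenius map on `H¹(X', 𝒪_{X'})`. -/
def frobenius {k : Type u} [Field k] {X' : Scheme.{u}} (s : X' ⟶ Spec (.of k)) (p : ℕ) [Fact p.Prime] [CharP k p] :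
    (structureSheafAb X').H 1 →+ (structureSheafAb X').H 1 :=
  Sheaf.H.map (frobeniusSheaf s p) 1

lemma stalkPullback_germ [IsDominant π] (U : X'.Opens) (x : X') (hx : x ∈ U) (f : Γ(X', U)) :
    stalkPullback s π x (X'.presheaf.germ U x hx f) =
      (π.stalkMap (genericPoint X)).hom (X'.presheaf.germ U (π (genericPoint X))
        ((specializes_of_isDominant π x).mem_open U.2 hx) f) := by
  change (π.stalkMap (genericPoint X)).hom ((X'.presheaf.stalkSpecializes _).hom _) = _
  congr 1
  exact congrArg (fun φ => φ.hom f)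
    (X'.presheaf.germ_stalkSpecializes hx (specializes_of_isDominant π x))

lemma smul_mem_regularAt [IsDominant π] (x : X') (f : X'.presheaf.stalk x)
    {ω} (hω : ω ∈ regularAt s π x) : stalkPullback s π x f • ω ∈ regularAt s π x := fun g => by
  rw [smul_smul, ← map_mul]
  exact hω (g * f)

/-- The section `f ω` of `Ω_{X'}` on `U`, for `f ∈ 𝒪(U)` and a global regular `ω`. -/
def mulSection [IsDominant π] (ω : regularDifferentials s π) (U : X'.Opens) :
    Γ(X', U) →+ constSections (regularStalk s π) U :=
  AddMonoidHom.mk'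
    (fun f => ⟨fun x => stalkPullback s π x.1 (X'.presheaf.germ U x.1 x.2 f) • ω.1, fun x =>
      ⟨U, x.2, 𝟙 _, stalkPullback s π x.1 (X'.presheaf.germ U x.1 x.2 f) • ω.1, fun y => by
        have h : stalkPullback s π x.1 (X'.presheaf.germ U x.1 x.2 f) =
            stalkPullback s π y.1 (X'.presheaf.germ U y.1 y.2 f) := by
          rw [stalkPullback_germ, stalkPullback_germ]
        refine ⟨by rw [h]; rfl, ?_⟩
        rw [h]
        exact smul_mem_regularAt s π y.1 _ ((Submodule.mem_iInf _).mp ω.2 y.1)⟩⟩)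
    fun f g => Subtype.ext <| funext fun x => by
      change stalkPullback s π x.1 (X'.presheaf.germ U x.1 x.2 (f + g)) • ω.1 =
        stalkPullback s π x.1 (X'.presheaf.germ U x.1 x.2 f) • ω.1 +
        stalkPullback s π x.1 (X'.presheaf.germ U x.1 x.2 g) • ω.1
      rw [map_add, map_add, add_smul]

/-- Multiplication by a global regular differential, `𝒪_{X'} → Ω_{X'}`, `f ↦ f ω`. -/
def mulForm [IsDominant π] (ω : regularDifferentials s π) :
    structureSheafAb X' ⟶ regularSheaf s π where
  hom :=
    { app := fun U => AddCommGrpCat.ofHom (mulSection s π ω U.unop)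
      naturality := fun U V i => by
        ext f
        refine Subtype.ext <| funext fun x => ?_
        change stalkPullback s π x.1 (X'.presheaf.germ V.unop x.1 x.2
            (X'.presheaf.map i (f : Γ(X', U.unop)))) • ω.1 =
          stalkPullback s π x.1 (X'.presheaf.germ U.unop x.1 (i.unop.le x.2)
            (f : Γ(X', U.unop))) • ω.1
        congr 2
        exact X'.presheaf.germ_res_apply i.unop x.1 x.2 (f : Γ(X', U.unop)) }

/-- The cup product `H¹(X', 𝒪_{X'}) × H⁰(X', Ω_{X'}) → H¹(X', Ω_{X'})`. -/
def cup [IsDominant π] (v : (structureSheafAb X').H 1) (ω : regularDifferentials s π) :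
    (regularSheaf s π).H 1 :=
  Sheaf.H.map (mulForm s π ω) 1 v

/-- The residue map `H¹(X', Ω_{X'}) → k`: the homomorphism induced, through the connecting
homomorphism of `0 → Ω_{X'} → Ω_{K(X)} → Ω_{K(X)}/Ω_{X'} → 0` (where `Ω_{K(X)}` is a constant
sheaf), by the sum of residues. For the normalization of a proper curve exactly one such
homomorphism exists, by the residue theorem and since `H¹` of the constant sheaf vanishes. -/
def residueMap [IsDominant π] : (regularSheaf s π).H 1 →+ k :=
  open Classical in
  if h : ∃ T : (regularSheaf s π).H 1 →+ k, ∀ σ r,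
      Represents (regularStalk s π) σ r →
        T (connecting (regularStalk s π) σ) = ∑ᶠ x : X', fibreResidue s π x (r x)
  then h.choose else 0

/-- The duality pairing `H¹(X', 𝒪_{X'}) × H⁰(X', Ω_{X'}) → H¹(X', Ω_{X'}) → k`. -/
def pairing [IsDominant π] (v : (structureSheafAb X').H 1) (ω : regularDifferentials s π) : k :=
  residueMap s π (cup s π v ω)

end Curve

end CartierRosenlicht

end

/-!
The proof rests on two properties of the Cartier operator `C` of the function field `K` of `X`.

* `C (f ^ p ω) = f C ω` (`cartier_pow_smul`).
* `Res_y (C ω) ^ p = Res_y ω` at every point `y` of `X` (`residue_cartier`), hence the same for the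
  sums of residues over the fibres of `π` (`fibreResidue_cartier`).

They are read off in a coordinate. As `K` is separable over some `k(x)`, every `t ∈ K` which is not
a `p`-th power is a `p`-basis: `K` has the basis `1, t, …, t ^ (p - 1)` over `K ^ p` (`PBasis`).
In terms of the coefficient functional `γ` of `t ^ (p - 1)`, the image of `f dt` under `C` is `g dt`
with `g ^ p = γ f` (`PBasis.isCartierImage_iff`); this depends on the identity
`γ (x ^ (p - 1) dx/dt) = (dx/dt) ^ p` (`PBasis.coeff_log`), and shows that `C` is well defined and
additive. A uniformizer `t` at `y` is a `p`-basis, and the residue formula is checked on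
`a t ^ (-i-1) dt` and on forms `f dt` with `f` regular at `y`. In the latter case `C` preserves
regularity since the valuations of the terms of `∑ c_i ^ p t ^ i` are distinct modulo `p`.

Part a) is then immediate: for `f ∈ 𝒪_{X', x}` the `p`-th power of the sum of residues of `f C ω` is
the sum of residues of `f ^ p ω`, which vanishes.

For part b), a constant sheaf on an irreducible space is flasque, so every class `v` in
`H¹(X', 𝒪_{X'})` is the coboundary of a section of `K / 𝒪_{X'}`, given locally by rational
functions `r_x` (`exists_comp_extClass_eq`, `exists_local_representative`). By naturality of the
connecting homomorphism (`exists_connecting_eq`), `F v · ω` and `v · C ω` are the coboundaries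
of the sections given locally by `r_x ^ p ω` and by `r_x C ω = C (r_x ^ p ω)`. Their residues are
related by `fibreResidue_cartier`, and the `p`-th power map of `k` is additive.
-/

noncomputable section

namespace CartierRosenlicht

open KaehlerDifferential

/-! ### The Cartier operator in a coordinate -/

/-- A derivation kills `p`-th powers in characteristic `p`. -/
lemma derivation_pow_char {k K M : Type*} [Field k] [Field K] [Algebra k K] [AddCommGroup M]
    [Module k M] [Module K M] (p : ℕ) [CharP K p] (δ : Derivation k K M) (c : K) :
    δ (c ^ p) = 0 := by
  rw [δ.leibniz_pow, ← Nat.cast_smul_eq_nsmul K, CharP.cast_eq_zero, zero_smul]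

/-- An element `t` which is a `p`-basis of `K`, presented by the `t`-derivative and by the
coefficient functional of `t ^ (p - 1)` in the expansion `f = ∑_{i < p} c_i ^ p t ^ i`. -/
structure PBasis (k : Type*) {K : Type*} [Field k] [Field K] [Algebra k K] (p : ℕ) (t : K) where
  /-- The derivative with respect to `t`. -/
  deriv : Derivation k K K
  /-- The coefficient `c_{p-1} ^ p` of `t ^ (p - 1)`. -/
  coeff : K →+ K
  deriv_self : deriv t = 1
  coeff_pow_mul : ∀ c f : K, coeff (c ^ p * f) = c ^ p * coeff f
  coeff_pow : ∀ i < p, coeff (t ^ i) = if i = p - 1 then 1 else 0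
  expansion : ∀ f : K, ∃ c : ℕ → K, f = ∑ i ∈ Finset.range p, c i ^ p * t ^ i

namespace PBasis

variable {k K : Type*} [Field k] [Field K] [Algebra k K] {p : ℕ} [Fact p.Prime] [CharP K p]
  {t : K} (B : PBasis k p t)

include B

omit [CharP K p] in
lemma coeff_sum (c : ℕ → K) :
    B.coeff (∑ i ∈ Finset.range p, c i ^ p * t ^ i) = c (p - 1) ^ p := by
  have hp : p.Prime := Fact.out
  rw [map_sum, Finset.sum_eq_single (p - 1)]
  · rw [B.coeff_pow_mul, B.coeff_pow _ (Nat.sub_lt hp.pos one_pos), if_pos rfl, mul_one]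
  · intro i hi hne
    rw [B.coeff_pow_mul, B.coeff_pow _ (Finset.mem_range.mp hi), if_neg hne, mul_zero]
  · intro h
    exact absurd (Finset.mem_range.mpr (Nat.sub_lt hp.pos one_pos)) h

omit [CharP K p] in
lemma exists_root (f : K) : ∃ c, c ^ p = B.coeff f := by
  obtain ⟨c, rfl⟩ := B.expansion f
  exact ⟨c (p - 1), (B.coeff_sum c).symm⟩

omit [Fact p.Prime] in
lemma deriv_pow_mul (c f : K) : B.deriv (c ^ p * f) = c ^ p * B.deriv f := by
  rw [B.deriv.leibniz, derivation_pow_char, smul_zero, add_zero, smul_eq_mul]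

omit [Fact p.Prime] in
lemma coeff_deriv (f : K) : B.coeff (B.deriv f) = 0 := by
  obtain ⟨c, rfl⟩ := B.expansion f
  rw [map_sum, map_sum]
  refine Finset.sum_eq_zero fun i hi => ?_
  rw [B.deriv_pow_mul, B.coeff_pow_mul, B.deriv.leibniz_pow, B.deriv_self, map_nsmul, smul_eq_mul,
    mul_one]
  obtain rfl | hpos := Nat.eq_zero_or_pos i
  · simp
  · have := Finset.mem_range.mp hi
    rw [B.coeff_pow _ (by omega), if_neg (by omega), smul_zero, mul_zero]

/-- In characteristic `p` a polynomial of degree at most `p - 2` has a primitive. -/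
lemma coeff_pow_mul_deriv (z : K) {i : ℕ} (hi : i < p - 1) :
    B.coeff (z ^ i * B.deriv z) = 0 := by
  have hp : p.Prime := Fact.out
  have hne : ((i + 1 : ℕ) : K) ≠ 0 := by
    rw [Ne, CharP.cast_eq_zero_iff K p]
    exact fun h => absurd (Nat.le_of_dvd i.succ_pos h) (by omega)
  -- Fermat: `(i + 1) ^ p = i + 1` in `K`, which moves the factor `i + 1` out of `coeff`
  have hF : ((i + 1 : ℕ) : K) ^ p = ((i + 1 : ℕ) : K) := by
    have := map_natCast (_root_.frobenius K p) (i + 1)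
    simpa [frobenius_def] using this
  have h := B.coeff_deriv (z ^ (i + 1))
  rw [B.deriv.leibniz_pow, Nat.add_sub_cancel, nsmul_eq_mul, smul_eq_mul, ← hF,
    B.coeff_pow_mul, hF] at h
  exact (mul_eq_zero.mp h).resolve_left hne

/-- The function `x ↦ coeff (x ^ (p - 1) x')` does not change when `1` is added to `x`. -/
lemma coeff_log_add_one (z : K) :
    B.coeff ((z + 1) ^ (p - 1) * B.deriv (z + 1)) = B.coeff (z ^ (p - 1) * B.deriv z) := by
  rw [map_add, B.deriv.map_one_eq_zero, add_zero, add_pow, Finset.sum_range_succ, add_mul, map_add,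
    Finset.sum_mul, map_sum, Finset.sum_eq_zero, zero_add]
  · simp
  · intro i hi
    have := B.coeff_pow_mul_deriv z (Finset.mem_range.mp hi)
    rw [one_pow, mul_one, mul_comm (z ^ i), mul_assoc, ← nsmul_eq_mul, map_nsmul, this, smul_zero]

omit [CharP K p] in
lemma coeff_log_mul (x y : K) :
    B.coeff ((x * y) ^ (p - 1) * B.deriv (x * y)) =
      x ^ p * B.coeff (y ^ (p - 1) * B.deriv y) + y ^ p * B.coeff (x ^ (p - 1) * B.deriv x) := by
  have hp : p = p - 1 + 1 := (Nat.sub_add_cancel (Fact.out : p.Prime).one_le).symm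
  rw [← B.coeff_pow_mul, ← B.coeff_pow_mul, ← map_add]
  congr 1
  rw [B.deriv.leibniz, smul_eq_mul, smul_eq_mul]
  have h : ∀ z : K, z ^ p = z ^ (p - 1) * z := fun z => by rw [← pow_succ, ← hp]
  rw [h x, h y]
  ring

lemma coeff_log_add (x y : K) :
    B.coeff ((x + y) ^ (p - 1) * B.deriv (x + y)) =
      B.coeff (x ^ (p - 1) * B.deriv x) + B.coeff (y ^ (p - 1) * B.deriv y) := by
  by_cases hy : y = 0
  · subst hy; simp
  -- `x + y = y (z + 1)` with `z = x / y`
  obtain ⟨z, rfl⟩ : ∃ z, x = y * z := ⟨x / y, by field_simp⟩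
  rw [show y * z + y = y * (z + 1) by ring, B.coeff_log_mul, B.coeff_log_mul, B.coeff_log_add_one,
    add_pow_char, one_pow]
  ring

/-- The identity behind the Cartier operator: `x ^ (p - 1) dx` is `(dx / dt) ^ p t ^ (p - 1) dt`
up to an exact form. Both sides are additive in `x` and satisfy the same product rule, so it is
enough to compare them on `p`-th powers and at `t`. -/
lemma coeff_log (x : K) : B.coeff (x ^ (p - 1) * B.deriv x) = B.deriv x ^ p := by
  have hp : p.Prime := Fact.out
  have hpow : ∀ c : K, B.coeff ((c ^ p) ^ (p - 1) * B.deriv (c ^ p)) = B.deriv (c ^ p) ^ p :=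
    fun c => by rw [derivation_pow_char, mul_zero, map_zero, zero_pow hp.ne_zero]
  have hmul : ∀ x y : K, B.coeff (x ^ (p - 1) * B.deriv x) = B.deriv x ^ p →
      B.coeff (y ^ (p - 1) * B.deriv y) = B.deriv y ^ p →
      B.coeff ((x * y) ^ (p - 1) * B.deriv (x * y)) = B.deriv (x * y) ^ p := fun x y hx hy => by
    rw [B.coeff_log_mul, hx, hy, B.deriv.leibniz, smul_eq_mul, smul_eq_mul, add_pow_char, mul_pow,
      mul_pow]
  have ht : ∀ i : ℕ, B.coeff ((t ^ i) ^ (p - 1) * B.deriv (t ^ i)) = B.deriv (t ^ i) ^ p := by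
    intro i
    induction i with
    | zero => simp [hp.ne_zero]
    | succ i ih =>
      rw [pow_succ]
      refine hmul _ _ ih ?_
      rw [B.deriv_self, mul_one, B.coeff_pow _ (Nat.sub_lt hp.pos one_pos), if_pos rfl, one_pow]
  obtain ⟨c, rfl⟩ := B.expansion x
  induction Finset.range p using Finset.induction_on with
  | empty => simp [hp.ne_zero]
  | insert i s hi ih =>
    rw [Finset.sum_insert hi, B.coeff_log_add, ih, hmul _ _ (hpow _) (ht i), map_add, add_pow_char]

omit [Fact p.Prime] in
/-- Every differential is a multiple of `dt`. -/
lemma lift_smul_D (ω : Ω[K⁄k]) : B.deriv.liftKaehlerDifferential ω • D k K t = ω := by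
  have hD : ∀ x : K, B.deriv x • D k K t = D k K x := fun x => by
    obtain ⟨c, rfl⟩ := B.expansion x
    rw [map_sum, map_sum, Finset.sum_smul]
    refine Finset.sum_congr rfl fun i _ => ?_
    rw [B.deriv_pow_mul, (D k K).leibniz, derivation_pow_char p, smul_zero, add_zero, mul_smul,
      B.deriv.leibniz_pow, (D k K).leibniz_pow, B.deriv_self, smul_assoc, smul_eq_mul, mul_one]
  have h : ω ∈ Submodule.span K (Set.range (D k K)) := by
    rw [span_range_derivation]; trivial
  induction h using Submodule.span_induction with
  | mem _ hx =>
    obtain ⟨x, rfl⟩ := hx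
    rw [Derivation.liftKaehlerDifferential_comp_D, hD]
  | zero => simp
  | add _ _ _ _ h₁ h₂ => rw [map_add, add_smul, h₁, h₂]
  | smul a _ _ h => rw [map_smul, smul_assoc, h]

omit [Fact p.Prime] [CharP K p] in
@[simp]
lemma lift_smul_D_self (f : K) : B.deriv.liftKaehlerDifferential (f • D k K t) = f := by
  rw [map_smul, Derivation.liftKaehlerDifferential_comp_D, B.deriv_self, smul_eq_mul, mul_one]

end PBasis

namespace PBasis

variable {k K : Type u} [Field k] [Field K] [Algebra k K] {p : ℕ} [Fact p.Prime] [CharP K p]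
  {t : K} (B : PBasis k p t)

include B

/-- In the coordinate `f dt ↦ f`, the Cartier operator is the `p`-th root of the coefficient of
`t ^ (p - 1)`. -/
lemma isCartierImage_iff (ω η : Ω[K⁄k]) :
    IsCartierImage p ω η ↔ B.deriv.liftKaehlerDifferential η ^ p =
      B.coeff (B.deriv.liftKaehlerDifferential ω) := by
  have hp : p.Prime := Fact.out
  constructor
  · rintro ⟨a, x, h, rfl, rfl⟩
    rw [map_add, map_smul, map_smul, Derivation.liftKaehlerDifferential_comp_D,
      Derivation.liftKaehlerDifferential_comp_D, smul_eq_mul, smul_eq_mul, map_add, B.coeff_deriv,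
      add_zero, mul_assoc, B.coeff_pow_mul, B.coeff_log, mul_pow]
  · intro h
    obtain ⟨c, hc⟩ := B.expansion (B.deriv.liftKaehlerDifferential ω)
    rw [hc, B.coeff_sum] at h
    have h' : B.deriv.liftKaehlerDifferential η = c (p - 1) := frobenius_inj K p h
    refine ⟨c (p - 1), t, ∑ i ∈ Finset.range (p - 1), (c i / (i + 1 : ℕ)) ^ p * t ^ (i + 1),
      ?_, ?_⟩
    · conv_lhs => rw [← B.lift_smul_D ω, hc, ← Nat.sub_add_cancel hp.one_le,
        Finset.sum_range_succ, add_smul, add_comm]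
      rw [Nat.sub_add_cancel hp.one_le, map_sum, Finset.sum_smul]
      congr 1
      refine Finset.sum_congr rfl fun i hi => ?_
      have hi := Finset.mem_range.mp hi
      have hne : ((i + 1 : ℕ) : K) ≠ 0 := by
        rw [Ne, CharP.cast_eq_zero_iff K p]
        exact fun h => absurd (Nat.le_of_dvd i.succ_pos h) (by omega)
      have hF : ((i + 1 : ℕ) : K) ^ p = ((i + 1 : ℕ) : K) := by
        have := map_natCast (_root_.frobenius K p) (i + 1)
        simpa [frobenius_def] using this
      rw [(D k K).leibniz, derivation_pow_char p, smul_zero, add_zero, (D k K).leibniz_pow,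
        Nat.add_sub_cancel, ← Nat.cast_smul_eq_nsmul K, smul_smul, smul_smul, div_pow, hF]
      congr 1
      field_simp
    · rw [← h', B.lift_smul_D]

lemma exists_isCartierImage (ω : Ω[K⁄k]) : ∃ η, IsCartierImage p ω η := by
  obtain ⟨c, hc⟩ := B.exists_root (B.deriv.liftKaehlerDifferential ω)
  exact ⟨c • D k K t, (B.isCartierImage_iff _ _).mpr (by rw [B.lift_smul_D_self, hc])⟩

lemma isCartierImage_cartier (ω : Ω[K⁄k]) : IsCartierImage p ω (cartier p ω) := by
  have h := B.exists_isCartierImage ω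
  rw [cartier, dif_pos h]
  exact h.choose_spec

lemma isCartierImage_unique {ω η η' : Ω[K⁄k]} (h : IsCartierImage p ω η)
    (h' : IsCartierImage p ω η') : η = η' := by
  rw [B.isCartierImage_iff] at h h'
  rw [← B.lift_smul_D η, ← B.lift_smul_D η',
    frobenius_inj K p (h.trans h'.symm : _root_.frobenius K p _ = _root_.frobenius K p _)]

lemma cartier_smul_D {f g : K} (h : g ^ p = B.coeff f) :
    cartier p (f • D k K t) = g • D k K t :=
  B.isCartierImage_unique (B.isCartierImage_cartier _)
    ((B.isCartierImage_iff _ _).mpr (by rwa [B.lift_smul_D_self, B.lift_smul_D_self]))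

lemma cartier_add (ω η : Ω[K⁄k]) : cartier p (ω + η) = cartier p ω + cartier p η := by
  refine B.isCartierImage_unique (B.isCartierImage_cartier _) ?_
  have h₁ := B.isCartierImage_cartier ω
  have h₂ := B.isCartierImage_cartier η
  rw [B.isCartierImage_iff] at h₁ h₂ ⊢
  rw [map_add, map_add, map_add, add_pow_char, h₁, h₂]

/-- The Cartier operator is `p⁻¹`-linear. -/
lemma cartier_pow_smul (f : K) (ω : Ω[K⁄k]) : cartier p (f ^ p • ω) = f • cartier p ω := by
  refine B.isCartierImage_unique (B.isCartierImage_cartier _) ?_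
  have h := B.isCartierImage_cartier ω
  rw [B.isCartierImage_iff] at h ⊢
  rw [map_smul, map_smul, smul_eq_mul, smul_eq_mul, B.coeff_pow_mul, mul_pow, h]

end PBasis

/-- If `t` is not a `p`-th power and generates `K` over `K ^ p`, then it is a `p`-basis. -/
lemma nonempty_pBasis {k K : Type*} [Field k] [Field K] [Algebra k K] (p : ℕ) [Fact p.Prime]
    [CharP K p] (hk : ∀ a : k, ∃ b, b ^ p = a) {t : K} (ht : ∀ b, b ^ p ≠ t)
    (htop : Algebra.adjoin (_root_.frobenius K p).fieldRange {t} = ⊤) :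
    Nonempty (PBasis k p t) := by
  have hp : p.Prime := Fact.out
  let F := (_root_.frobenius K p).fieldRange
  have hF : ∀ c : K, c ^ p ∈ F := fun c => ⟨c, rfl⟩
  let a : F := ⟨t ^ p, hF t⟩
  have hirr : Irreducible (Polynomial.X ^ p - Polynomial.C a) := by
    refine X_pow_sub_C_irreducible_of_prime hp fun b hb => ?_
    obtain ⟨c, hc⟩ := b.2
    refine ht c ?_
    have hb' : (b : K) ^ p = t ^ p := congrArg Subtype.val hb
    exact (hc : c ^ p = b).trans (frobenius_inj K p hb')
  have hroot : Polynomial.aeval t (Polynomial.X ^ p - Polynomial.C a) = 0 := by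
    rw [map_sub, map_pow, Polynomial.aeval_X, Polynomial.aeval_C]
    exact sub_self _
  have hmonic : (Polynomial.X ^ p - Polynomial.C a).Monic :=
    Polynomial.monic_X_pow_sub_C a hp.ne_zero
  have hint : IsIntegral F t := ⟨_, hmonic, hroot⟩
  let P := PowerBasis.ofAdjoinEqTop hint htop
  have hgen : P.gen = t := PowerBasis.ofAdjoinEqTop_gen hint htop
  have hdim : P.dim = p := by
    rw [← P.natDegree_minpoly, hgen, ← minpoly.eq_of_irreducible_of_monic hirr hroot hmonic,
      Polynomial.natDegree_X_pow_sub_C]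
  let b : Module.Basis (Fin p) F K := P.basis.reindex (finCongr hdim)
  have hb : ∀ i : Fin p, b i = t ^ (i : ℕ) := fun i => by
    simp [b, hgen]
  have hsmul : ∀ c f : K, c ^ p * f = (⟨c ^ p, hF c⟩ : F) • f := fun c f => rfl
  let δ : K →ₗ[F] K := b.constr F fun i => (i : ℕ) • t ^ ((i : ℕ) - 1)
  have hδ : ∀ n : ℕ, δ (t ^ n) = n • t ^ (n - 1) := fun n => by
    have hlt := Nat.mod_lt n hp.pos
    have h1 : t ^ n = (⟨(t ^ (n / p)) ^ p, hF _⟩ : F) • b ⟨n % p, hlt⟩ := by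
      rw [hb, ← hsmul, ← pow_mul, ← pow_add, mul_comm, Nat.div_add_mod]
    rw [h1, map_smul, b.constr_basis, ← hsmul, mul_smul_comm, ← Nat.cast_smul_eq_nsmul K,
      ← Nat.cast_smul_eq_nsmul K n]
    have h2 : ((n % p : ℕ) : K) = n := by
      conv_rhs => rw [← Nat.div_add_mod n p]
      simp
    rw [h2]
    obtain h0 | h0 := Nat.eq_zero_or_pos (n % p)
    · have hn : (n : K) = 0 := by rw [← h2, h0, Nat.cast_zero]
      rw [hn, zero_smul, zero_smul]
    · rw [← pow_mul, ← pow_add]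
      congr 2
      have := Nat.div_add_mod n p
      rw [mul_comm] at this
      change n / p * p + (n % p - 1) = n - 1
      omega
  have hleib : ∀ x y : K, δ (x * y) = x * δ y + y * δ x := by
    let L : K →ₗ[F] K →ₗ[F] K := (LinearMap.mul F K).compr₂ δ
    let R : K →ₗ[F] K →ₗ[F] K := (LinearMap.mul F K).compl₂ δ + ((LinearMap.mul F K).compl₂ δ).flip
    have : L = R := by
      refine b.ext fun i => b.ext fun j => ?_
      simp only [L, R, LinearMap.compr₂_apply, LinearMap.mul_apply', LinearMap.add_apply,
        LinearMap.compl₂_apply, LinearMap.flip_apply]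
      rw [hb, hb, ← pow_add, hδ, hδ, hδ]
      obtain ⟨i, hi⟩ := i
      obtain ⟨j, hj⟩ := j
      simp only [nsmul_eq_mul]
      rcases i with _ | i <;> rcases j with _ | j <;> simp
      ring
    intro x y
    have := LinearMap.congr_fun₂ this x y
    simpa only [L, R, LinearMap.compr₂_apply, LinearMap.mul_apply', LinearMap.add_apply,
        LinearMap.compl₂_apply, LinearMap.flip_apply] using this
  have hδk : ∀ (c : k) (x : K), δ (c • x) = c • δ x := fun c x => by
    obtain ⟨c, rfl⟩ := hk c
    rw [Algebra.smul_def, Algebra.smul_def, map_pow, hsmul, hsmul, map_smul]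
  refine ⟨{
    deriv := Derivation.mk' { toFun := δ, map_add' := map_add δ, map_smul' := hδk } hleib
    coeff := (F.subtype : F →+ K).comp
      (b.coord ⟨p - 1, Nat.sub_lt hp.pos one_pos⟩).toAddMonoidHom
    deriv_self := ?_
    coeff_pow_mul := fun c f => ?_
    coeff_pow := fun i hi => ?_
    expansion := fun f => ?_ }⟩
  · simpa using hδ 1
  · change ((b.coord _ (c ^ p * f) : F) : K) = c ^ p * (b.coord _ f : F)
    rw [hsmul, map_smul]
    rfl
  · change ((b.coord _ (t ^ i) : F) : K) = _
    rw [show t ^ i = b ⟨i, hi⟩ from (hb ⟨i, hi⟩).symm, b.coord_apply, b.repr_self,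
      Finsupp.single_apply]
    simp only [Fin.mk.injEq]
    split_ifs <;> rfl
  · have hc : ∀ i : ℕ, ∃ c : K, ∀ h : i < p, c ^ p = (b.repr f ⟨i, h⟩ : K) := fun i => by
      by_cases h : i < p
      · obtain ⟨c, hc⟩ := (b.repr f ⟨i, h⟩).2
        exact ⟨c, fun _ => hc⟩
      · exact ⟨0, fun h' => absurd h' h⟩
    choose c hc using hc
    refine ⟨c, ?_⟩
    rw [Finset.sum_range]
    conv_lhs => rw [← b.sum_repr f]
    refine Finset.sum_congr rfl fun i _ => ?_
    rw [hc i i.2, hb]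
    rfl

/-! ### Residues and the Cartier operator -/

section DVR

variable {R K : Type*} [CommRing R] [IsDomain R] [IsDiscreteValuationRing R] [Field K]
  [Algebra R K] [IsFractionRing R K] {t : R}

lemma exists_mul_pow_eq_algebraMap (ht : Irreducible t) (x : K) :
    ∃ (N : ℕ) (r : R), x * algebraMap R K t ^ N = algebraMap R K r := by
  obtain ⟨a, b, hb, rfl⟩ := IsFractionRing.div_surjective (A := R) x
  have hb0 : b ≠ 0 := nonZeroDivisors.ne_zero hb
  obtain ⟨N, u, rfl⟩ := IsDiscreteValuationRing.eq_unit_mul_pow_irreducible hb0 ht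
  refine ⟨N, a * (u⁻¹ : Rˣ), ?_⟩
  have hu : algebraMap R K u * algebraMap R K (u⁻¹ : Rˣ) = 1 := by
    rw [← map_mul, Units.mul_inv, map_one]
  rw [div_mul_eq_mul_div, div_eq_iff, map_mul, map_mul, map_pow]
  · linear_combination -(algebraMap R K a * algebraMap R K t ^ N) * hu
  · exact (map_ne_zero_iff _ (IsFractionRing.injective R K)).mpr hb0

omit [IsDiscreteValuationRing R] in
/-- The exponents `p v(r_i) + i` are distinct modulo `p`, so the terms of `∑ r_i ^ p t ^ i` cannot
cancel. -/
lemma dvd_of_pow_dvd_sum {p : ℕ} (hprime : Prime t) {r : ℕ → R}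
    (h : t ^ p ∣ ∑ i ∈ Finset.range p, r i ^ p * t ^ i) :
    ∀ i < p, t ∣ r i := by
  intro i
  induction i using Nat.strong_induction_on with
  | _ i ih =>
    intro hi
    have hmem := Finset.mem_range.mpr hi
    rw [← Finset.add_sum_erase _ _ hmem] at h
    have hrest : t ^ (i + 1) ∣ ∑ j ∈ (Finset.range p).erase i, r j ^ p * t ^ j := by
      refine Finset.dvd_sum fun j hj => ?_
      obtain ⟨hne, hj⟩ := Finset.mem_erase.mp hj
      have hj := Finset.mem_range.mp hj
      rcases lt_or_gt_of_ne hne with hlt | hgt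
      · exact Dvd.dvd.mul_right ((pow_dvd_pow t hi).trans (pow_dvd_pow_of_dvd (ih j hlt hj) p)) _
      · exact Dvd.dvd.mul_left (pow_dvd_pow t hgt) _
    have h1 := (dvd_add_left hrest).mp ((pow_dvd_pow t hi).trans h)
    rw [pow_succ', mul_dvd_mul_iff_right (pow_ne_zero i hprime.ne_zero)] at h1
    exact hprime.dvd_of_dvd_pow h1

omit [IsDiscreteValuationRing R] in
lemma pow_dvd_of_pow_dvd_sum {p : ℕ} (hprime : Prime t) (N : ℕ) {r : ℕ → R}
    (h : t ^ (N * p) ∣ ∑ i ∈ Finset.range p, r i ^ p * t ^ i) :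
    ∀ i < p, t ^ N ∣ r i := by
  induction N generalizing r with
  | zero => simp
  | succ N ih =>
    rw [Nat.succ_mul, add_comm, pow_add] at h
    have h1 := dvd_of_pow_dvd_sum hprime (dvd_of_mul_right_dvd h)
    have h2 : ∀ i, ∃ s, i < p → r i = t * s := fun i => by
      by_cases hi : i < p
      · obtain ⟨s, hs⟩ := h1 i hi
        exact ⟨s, fun _ => hs⟩
      · exact ⟨0, fun h => absurd h hi⟩
    choose s hs using h2
    have h3 : ∑ i ∈ Finset.range p, r i ^ p * t ^ i =
        t ^ p * ∑ i ∈ Finset.range p, s i ^ p * t ^ i := by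
      rw [Finset.mul_sum]
      refine Finset.sum_congr rfl fun i hi => ?_
      rw [hs i (Finset.mem_range.mp hi), mul_pow, mul_assoc]
    rw [h3, mul_dvd_mul_iff_left (pow_ne_zero p hprime.ne_zero)] at h
    intro i hi
    rw [hs i hi, pow_succ']
    exact mul_dvd_mul_left t (ih h i hi)

/-- If `∑_{i < p} c_i ^ p t ^ i` is integral at `R`, then so are all `c_i`. -/
lemma mem_range_of_sum_mem_range (ht : Irreducible t) {p : ℕ} {c : ℕ → K} {g : R}
    (h : algebraMap R K g = ∑ i ∈ Finset.range p, c i ^ p * algebraMap R K t ^ i)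
    {i : ℕ} (hi : i < p) : ∃ r : R, algebraMap R K r = c i := by
  have ht0 : algebraMap R K t ≠ 0 :=
    (map_ne_zero_iff _ (IsFractionRing.injective R K)).mpr ht.ne_zero
  choose n s hs using fun j => exists_mul_pow_eq_algebraMap (K := K) ht (c j)
  let N := (Finset.range p).sup n
  have hn : ∀ j < p, n j ≤ N := fun j hj => Finset.le_sup (f := n) (Finset.mem_range.mpr hj)
  let r : ℕ → R := fun j => s j * t ^ (N - n j)
  have hr : ∀ j < p, c j * algebraMap R K t ^ N = algebraMap R K (r j) := fun j hj => by
    rw [map_mul, ← hs, map_pow, mul_assoc, ← pow_add, Nat.add_sub_cancel' (hn j hj)]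
  have hdvd : t ^ (N * p) ∣ ∑ j ∈ Finset.range p, r j ^ p * t ^ j := by
    refine ⟨g, IsFractionRing.injective R K ?_⟩
    rw [map_mul, h, map_sum, Finset.mul_sum]
    refine Finset.sum_congr rfl fun j hj => ?_
    rw [map_mul, map_pow, ← hr j (Finset.mem_range.mp hj), mul_pow, ← pow_mul, map_pow, map_pow]
    ring
  obtain ⟨q, hq⟩ := pow_dvd_of_pow_dvd_sum ht.prime N hdvd i hi
  refine ⟨q, mul_right_cancel₀ (pow_ne_zero N ht0) ?_⟩
  rw [hr i hi, hq, map_mul, map_pow, mul_comm]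

end DVR

section Residue

variable {k : Type u} [Field k] [IsAlgClosed k] {R K : Type u} [CommRing R] [IsDomain R]
  [IsDiscreteValuationRing R] [Field K] [Algebra k K] [Algebra R K] [IsFractionRing R K]
  {p : ℕ} [Fact p.Prime] [CharP K p] {t : R} (ht : Irreducible t)
  (B : PBasis k p (algebraMap R K t))
  (hres : ∀ r : R, ∃ (c : k) (r' : R), algebraMap R K r =
    algebraMap k K c + algebraMap R K t * algebraMap R K r')

include ht B hres

/-- A functional that reads off the coefficient of `t⁻¹ dt` satisfies
`Res (C ω) ^ p = Res ω`. Both sides are additive, so it is enough to treat the polar terms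
`a t ^ (-i-1) dt` and the forms regular at `R`. -/
lemma residue_cartier_of_spec (ρ : Ω[K⁄k] →ₗ[k] k)
    (hρ : ∀ (m : ℕ) (a : ℕ → k) (g : R),
      ρ ((∑ i ∈ Finset.range (m + 1), algebraMap k K (a i) * ((algebraMap R K t)⁻¹) ^ (i + 1) +
        algebraMap R K g) • D k K (algebraMap R K t)) = a 0) (ω : Ω[K⁄k]) :
    ρ (cartier p ω) ^ p = ρ ω := by
  have hp : p.Prime := Fact.out
  have : CharP k p := (RingHom.charP_iff_charP (algebraMap k K) p).mpr inferInstance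
  set T := algebraMap R K t with hT
  have ht0 : T ≠ 0 := (map_ne_zero_iff _ (IsFractionRing.injective R K)).mpr ht.ne_zero
  have hpolar : ∀ (a : k) (i : ℕ),
      ρ ((algebraMap k K a * T⁻¹ ^ (i + 1)) • D k K T) = if i = 0 then a else 0 := fun a i => by
    have := hρ i (fun j => if j = i then a else 0) 0
    simp only [apply_ite (algebraMap k K), map_zero, ite_mul, zero_mul, Finset.sum_ite_eq',
      Finset.mem_range, Nat.lt_succ_self, if_true, add_zero] at this
    rw [this]
    exact if_congr eq_comm rfl rfl
  have hreg : ∀ g : R, ρ (algebraMap R K g • D k K T) = 0 := fun g => by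
    simpa using hρ 0 0 g
  have hadd : ∀ f₁ f₂ : K, ρ (cartier p (f₁ • D k K T)) ^ p = ρ (f₁ • D k K T) →
      ρ (cartier p (f₂ • D k K T)) ^ p = ρ (f₂ • D k K T) →
      ρ (cartier p ((f₁ + f₂) • D k K T)) ^ p = ρ ((f₁ + f₂) • D k K T) := fun f₁ f₂ h₁ h₂ => by
    rw [add_smul, B.cartier_add, map_add, map_add, add_pow_char, h₁, h₂]
  have hint : ∀ g : R, ρ (cartier p (algebraMap R K g • D k K T)) ^ p =
      ρ (algebraMap R K g • D k K T) := fun g => by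
    obtain ⟨c, hc⟩ := B.expansion (algebraMap R K g)
    obtain ⟨r, hr⟩ := mem_range_of_sum_mem_range ht hc (Nat.sub_lt hp.pos one_pos)
    have hcoeff : algebraMap R K r ^ p = B.coeff (algebraMap R K g) := by
      rw [hc, B.coeff_sum, hr]
    rw [B.cartier_smul_D hcoeff, hreg, hreg, zero_pow hp.ne_zero]
  have hpol : ∀ (a : k) (i : ℕ),
      ρ (cartier p ((algebraMap k K a * T⁻¹ ^ (i + 1)) • D k K T)) ^ p =
        ρ ((algebraMap k K a * T⁻¹ ^ (i + 1)) • D k K T) := fun a i => by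
    obtain ⟨b, rfl⟩ := IsAlgClosed.exists_pow_nat_eq a hp.pos
    have hlt := Nat.mod_lt i hp.pos
    -- `t ^ (-i-1) = (t ^ (-q)) ^ p t ^ e` with `q = i / p + 1` and `e = p - 1 - i % p < p`
    have hexp : algebraMap k K (b ^ p) * T⁻¹ ^ (i + 1) =
        (algebraMap k K b * T⁻¹ ^ (i / p + 1)) ^ p * T ^ (p - 1 - i % p) := by
      have h1 : (i / p + 1) * p = (i + 1) + (p - 1 - i % p) := by
        have := Nat.div_add_mod i p
        rw [add_mul, mul_comm (i / p), one_mul]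
        omega
      rw [mul_pow, ← pow_mul, h1, pow_add _ (i + 1), map_pow, mul_assoc, mul_assoc, ← mul_pow,
        inv_mul_cancel₀ ht0, one_pow, mul_one]
    have hcoeff := B.coeff_pow_mul (algebraMap k K b * T⁻¹ ^ (i / p + 1)) (T ^ (p - 1 - i % p))
    rw [← hexp, B.coeff_pow _ (by omega)] at hcoeff
    by_cases hi : i % p = 0
    · rw [if_pos (by omega), mul_one] at hcoeff
      rw [B.cartier_smul_D hcoeff.symm, hpolar, hpolar]
      have h0 : i / p = 0 ↔ i = 0 := by
        constructor
        · intro h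
          have := Nat.div_add_mod i p
          rw [h, hi] at this
          simpa using this.symm
        · rintro rfl
          exact Nat.zero_div p
      by_cases h : i = 0
      · rw [if_pos (h0.mpr h), if_pos h]
      · rw [if_neg (mt h0.mp h), if_neg h, zero_pow hp.ne_zero]
    · rw [if_neg (by omega), mul_zero, ← zero_pow hp.ne_zero] at hcoeff
      rw [B.cartier_smul_D hcoeff.symm, zero_smul, map_zero, zero_pow hp.ne_zero, hpolar,
        if_neg (by rintro rfl; exact hi (Nat.zero_mod p))]
  have hfrac : ∀ (N : ℕ) (r : R),
      ρ (cartier p ((algebraMap R K r * T⁻¹ ^ N) • D k K T)) ^ p =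
        ρ ((algebraMap R K r * T⁻¹ ^ N) • D k K T) := fun N => by
    induction N with
    | zero => intro r; rw [pow_zero, mul_one]; exact hint r
    | succ N ih =>
      intro r
      obtain ⟨c, r', hr⟩ := hres r
      have : algebraMap R K r * T⁻¹ ^ (N + 1) =
          algebraMap k K c * T⁻¹ ^ (N + 1) + algebraMap R K r' * T⁻¹ ^ N := by
        rw [hr, pow_succ]
        field_simp
      rw [this]
      exact hadd _ _ (hpol c N) (ih r')
  obtain ⟨N, r, hr⟩ := exists_mul_pow_eq_algebraMap ht (B.deriv.liftKaehlerDifferential ω)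
  have h := hfrac N r
  rwa [← hr, ← hT, mul_assoc, ← mul_pow, mul_inv_cancel₀ ht0, one_pow, mul_one,
    B.lift_smul_D] at h

end Residue

/-! ### `p`-bases of function fields in one variable -/

/-- A domain of dimension at most one is not integral over a polynomial ring in two or more
variables: a prime above `(X₀)` is maximal, whereas `(X₀)` is not. -/
lemma card_le_one_of_isIntegral {k A : Type*} [Field k] [CommRing A] [IsDomain A]
    [Ring.DimensionLEOne A] {n : ℕ} (g : MvPolynomial (Fin n) k →+* A)
    (hg : Function.Injective g) (hint : g.IsIntegral) : n ≤ 1 := by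
  by_contra! hn
  algebraize [g]
  have : Algebra.IsIntegral (MvPolynomial (Fin n) k) A := ⟨hint⟩
  let i : Fin n := ⟨0, by omega⟩
  let j : Fin n := ⟨1, hn⟩
  have hij : j ≠ i := by simp [i, j]
  let P : Ideal (MvPolynomial (Fin n) k) := Ideal.span {MvPolynomial.X i}
  have hP : P.IsPrime := (Ideal.span_singleton_prime (MvPolynomial.X_ne_zero i)).mpr
    MvPolynomial.X_prime
  obtain ⟨Q, -, hQ, hQP⟩ := Ideal.exists_ideal_over_prime_of_isIntegral (S := A) P ⊥ (by
    rw [Ideal.comap_bot_of_injective (algebraMap (MvPolynomial (Fin n) k) A) hg]; exact bot_le)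
  have hQ0 : Q ≠ ⊥ := by
    rintro rfl
    rw [Ideal.comap_bot_of_injective (algebraMap (MvPolynomial (Fin n) k) A) hg] at hQP
    have : (MvPolynomial.X i : MvPolynomial (Fin n) k) ∈ P := Ideal.mem_span_singleton_self _
    rw [← hQP] at this
    exact MvPolynomial.X_ne_zero i this
  have hQm := hQ.isMaximal hQ0
  have hPm : P.IsMaximal := hQP ▸ Ideal.isMaximal_comap_of_isIntegral_of_isMaximal Q
  have hj : (MvPolynomial.X j : MvPolynomial (Fin n) k) ∉ P := fun h => by
    obtain ⟨f, hf⟩ := Ideal.mem_span_singleton.mp h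
    have := congrArg (MvPolynomial.eval (fun l => if l = j then (1 : k) else 0)) hf
    simp [hij.symm] at this
  obtain ⟨f, b, hb, h1⟩ := hPm.exists_inv hj
  obtain ⟨c, rfl⟩ := Ideal.mem_span_singleton.mp hb
  have := congrArg (MvPolynomial.eval (fun _ => (0 : k))) h1
  simp at this

/-- The function field of an affine curve over a perfect field is separable over `k(x)` for
some `x`. -/
lemma exists_isSeparable_adjoin_simple (k A K : Type*) [Field k] [PerfectField k] [CommRing A]
    [IsDomain A] [Algebra k A] [Algebra.FiniteType k A] [Ring.DimensionLEOne A] [Field K]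
    [Algebra A K] [IsFractionRing A K] [Algebra k K] [IsScalarTower k A K] :
    ∃ x : K, Algebra.IsSeparable (IntermediateField.adjoin k {x}) K := by
  obtain ⟨n, g, hg, hint⟩ := exists_integral_inj_algHom_of_fg k A
  have hn : n ≤ 1 := card_le_one_of_isIntegral g.toRingHom hg hint
  have : Algebra.EssFiniteType A K := .of_isLocalization _ (nonZeroDivisors A)
  have : Algebra.EssFiniteType k K := .comp k A K
  obtain ⟨S, hS, hsep⟩ := exists_isTranscendenceBasis_and_isSeparable_of_perfectField k K
  have hcard : S.card ≤ 1 := by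
    algebraize [g.toRingHom]
    have : Algebra.IsIntegral (MvPolynomial (Fin n) k) A := ⟨hint⟩
    have : FaithfulSMul (MvPolynomial (Fin n) k) A :=
      (faithfulSMul_iff_algebraMap_injective _ _).mpr hg
    have : IsScalarTower k (MvPolynomial (Fin n) k) A :=
      IsScalarTower.of_algebraMap_eq' g.comp_algebraMap.symm
    have : Algebra.IsAlgebraic A K := IsLocalization.isAlgebraic K (nonZeroDivisors A)
    have h₁ : IsTranscendenceBasis k (algebraMap (MvPolynomial (Fin n) k) A ∘ MvPolynomial.X) :=
      (IsTranscendenceBasis.mvPolynomial (Fin n) k).algebraMap_comp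
    have h₂ := (h₁.algebraMap_comp (A := K)).lift_cardinalMk_eq hS
    simp at h₂
    omega
  obtain ⟨x, hx⟩ := Finset.card_le_one_iff_subset_singleton.mp hcard
  refine ⟨x, ?_⟩
  rw [Finset.subset_singleton_iff] at hx
  obtain rfl | rfl := hx
  · have h : IntermediateField.adjoin k ((∅ : Finset K) : Set K) ≤ IntermediateField.adjoin k {x} :=
      IntermediateField.adjoin.mono _ _ _ (by simp)
    algebraize [(IntermediateField.inclusion h).toRingHom]
    have : IsScalarTower (IntermediateField.adjoin k ((∅ : Finset K) : Set K))
      (IntermediateField.adjoin k {x}) K := IsScalarTower.of_algebraMap_eq' rfl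
    exact Algebra.isSeparable_tower_top_of_isSeparable
      (IntermediateField.adjoin k ((∅ : Finset K) : Set K)) _ _
  · rwa [Finset.coe_singleton] at hsep

/-- If `K` is separable over `k(x)` then `K` is generated over `K ^ p` by any element which is not
a `p`-th power. -/
lemma adjoin_frobenius_eq_top {k K : Type*} [Field k] [Field K] [Algebra k K] (p : ℕ)
    [Fact p.Prime] [CharP K p] (hk : ∀ a : k, ∃ b, b ^ p = a) (x : K)
    [Algebra.IsSeparable (IntermediateField.adjoin k {x}) K] {t : K} (ht : ∀ b, b ^ p ≠ t) :
    Algebra.adjoin (_root_.frobenius K p).fieldRange {t} = ⊤ := by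
  have hp : p.Prime := Fact.out
  let F := (_root_.frobenius K p).fieldRange
  have hF : ∀ c : K, c ^ p ∈ F := fun c => ⟨c, rfl⟩
  have hroot : ∀ y : K,
      Polynomial.aeval y (Polynomial.X ^ p - Polynomial.C (⟨y ^ p, hF y⟩ : F)) = 0 := fun y => by
    rw [map_sub, map_pow, Polynomial.aeval_X, Polynomial.aeval_C]
    exact sub_self _
  have hmonic : ∀ y : K, (Polynomial.X ^ p - Polynomial.C (⟨y ^ p, hF y⟩ : F)).Monic :=
    fun y => Polynomial.monic_X_pow_sub_C _ hp.ne_zero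
  have hint : ∀ y : K, IsIntegral F y := fun y => ⟨_, hmonic y, hroot y⟩
  have hx : IntermediateField.adjoin F {x} = ⊤ := by
    let M := IntermediateField.adjoin F {x}
    have hFM : ∀ y : K, y ^ p ∈ M := fun y => M.algebraMap_mem ⟨y ^ p, hF y⟩
    have hkM : ∀ a : k, algebraMap k K a ∈ M := fun a => by
      obtain ⟨b, rfl⟩ := hk a
      rw [map_pow]
      exact hFM _
    have hLM : IntermediateField.adjoin k {x} ≤ M.toSubfield.toIntermediateField hkM :=
      IntermediateField.adjoin_le_iff.mpr (Set.singleton_subset_iff.mpr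
        (IntermediateField.mem_adjoin_simple_self F x))
    have : CharP (IntermediateField.adjoin k {x}) p :=
      (RingHom.charP_iff_charP (algebraMap (IntermediateField.adjoin k {x}) K) p).mpr inferInstance
    have : ExpChar (IntermediateField.adjoin k {x}) p := .prime hp
    have h := IntermediateField.adjoin_eq_adjoin_pow_expChar_of_isSeparable'
      (IntermediateField.adjoin k {x}) K Set.univ p
    rw [IntermediateField.adjoin_univ] at h
    have hle : IntermediateField.adjoin (IntermediateField.adjoin k {x})
        ((· ^ p) '' (Set.univ : Set K)) ≤ M.toSubfield.toIntermediateField (fun l => hLM l.2) := by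
      rw [IntermediateField.adjoin_le_iff]
      rintro _ ⟨y, -, rfl⟩
      exact hFM y
    rw [← h] at hle
    exact eq_top_iff.mpr fun y _ => hle (IntermediateField.mem_top (x := y))
  have hfin : FiniteDimensional F (⊤ : IntermediateField F K) := by
    rw [← hx]
    exact IntermediateField.adjoin.finiteDimensional (hint x)
  have hle : Module.finrank F (⊤ : IntermediateField F K) ≤ p := by
    rw [← hx, IntermediateField.adjoin.finrank (hint x)]
    have := Polynomial.natDegree_le_of_dvd (minpoly.dvd F x (hroot x)) (hmonic x).ne_zero
    rwa [Polynomial.natDegree_X_pow_sub_C] at this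
  have hirr : Irreducible (Polynomial.X ^ p - Polynomial.C (⟨t ^ p, hF t⟩ : F)) := by
    refine X_pow_sub_C_irreducible_of_prime hp fun b hb => ?_
    obtain ⟨c, hc⟩ := b.2
    have hb' : (b : K) ^ p = t ^ p := congrArg Subtype.val hb
    exact ht c ((hc : c ^ p = b).trans (frobenius_inj K p hb'))
  have htop : IntermediateField.adjoin F {t} = ⊤ := by
    refine IntermediateField.eq_of_le_of_finrank_le le_top ?_
    rwa [IntermediateField.adjoin.finrank (hint t),
      ← minpoly.eq_of_irreducible_of_monic hirr (hroot t) (hmonic t),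
      Polynomial.natDegree_X_pow_sub_C]
  rw [← IntermediateField.adjoin_simple_toSubalgebra_of_isAlgebraic (hint t).isAlgebraic, htop,
    IntermediateField.top_toSubalgebra]

/-! ### Local rings of a normal curve -/

lemma dimensionLEOne_of_krullDimLE {A : Type*} [CommRing A] [IsDomain A] [Ring.KrullDimLE 1 A] :
    Ring.DimensionLEOne A where
  maximalOfPrime hp hp' := hp'.isMaximal_of_ne_bot hp

/-- A normal local ring of an affine curve which has an irreducible element is a discrete valuation
ring. -/
lemma isDiscreteValuationRing_of_localization {A R : Type*} [CommRing A]
    [IsDomain A] [IsNoetherianRing A] [Ring.DimensionLEOne A] [CommRing R] [IsDomain R]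
    [Algebra A R] (P : Ideal A) [P.IsPrime] [IsLocalization.AtPrime R P] [IsIntegrallyClosed R]
    {t : R} (ht : Irreducible t) : IsDiscreteValuationRing R := by
  have : IsLocalRing R := IsLocalization.AtPrime.isLocalRing R P
  have : IsNoetherianRing R := IsLocalization.isNoetherianRing P.primeCompl R inferInstance
  have hf : ¬ IsField R := fun h =>
    ht.not_isUnit ((h.mul_inv_cancel ht.ne_zero).elim fun _ => .of_mul_eq_one _)
  have : Ring.DimensionLEOne R := .localization R P.primeCompl_le_nonZeroDivisors
  have hR : IsDedekindDomain R := {}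
  exact ((IsDiscreteValuationRing.TFAE R hf).out 0 2).mpr hR

/-- The residue field at a closed point of a curve over an algebraically closed field is the
base field. -/
lemma exists_sub_mem_maximalIdeal {k A R : Type*} [Field k] [IsAlgClosed k] [CommRing A]
    [Algebra k A] [Algebra.FiniteType k A] [CommRing R] [IsLocalRing R] [Algebra A R]
    [Algebra k R] [IsScalarTower k A R] (P : Ideal A) [P.IsMaximal] [IsLocalization.AtPrime R P]
    (r : R) : ∃ c : k, r - algebraMap k R c ∈ IsLocalRing.maximalIdeal R := by
  obtain ⟨a, ha⟩ := (IsLocalization.AtPrime.equivQuotMaximalIdeal P R).surjective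
    (Ideal.Quotient.mk _ r)
  obtain ⟨a, rfl⟩ := Ideal.Quotient.mk_surjective a
  let := Ideal.Quotient.field P
  have : Module.Finite k (A ⧸ P) := finite_of_finite_type_of_isJacobsonRing k (A ⧸ P)
  obtain ⟨c, hc⟩ := (IsAlgClosed.algebraMap_bijective_of_isIntegral (k := k) (K := A ⧸ P)).2
    (Ideal.Quotient.mk P a)
  refine ⟨c, ?_⟩
  rw [← Ideal.Quotient.eq, ← ha, ← hc, IsScalarTower.algebraMap_apply k A R,
    IsScalarTower.algebraMap_apply k A (A ⧸ P)]
  exact IsLocalization.AtPrime.equivQuotMaximalIdeal_apply_mk P R _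

/-- A uniformizer is not a `p`-th power, since its valuation is `1`. -/
lemma not_pow_eq_algebraMap {R K : Type*} [CommRing R] [IsDomain R] [IsDiscreteValuationRing R]
    [Field K] [Algebra R K] [IsFractionRing R K] {t : R} (ht : Irreducible t) {p : ℕ} (hp : 1 < p)
    (b : K) : b ^ p ≠ algebraMap R K t := fun h => by
  obtain ⟨r, rfl⟩ := IsIntegrallyClosed.exists_algebraMap_eq_of_isIntegral_pow (R := R)
    (by omega : 0 < p) (h ▸ isIntegral_algebraMap)
  rw [← map_pow] at h
  rw [← IsFractionRing.injective R K h] at ht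
  exact not_irreducible_pow (by omega) ht

section Curve

variable {k : Type u} [Field k] {X X' : Scheme.{u}} [IsIntegral X]

lemma algebraMap_scalars (s : X ⟶ Spec (.of k)) (U : X.Opens) [Nonempty U] (c : k) :
    X.germToFunctionField U (scalars s U c) = algebraMap k (FunctionField s) c := by
  have h := X.presheaf.germ_res_apply (homOfLE (le_top : U ≤ ⊤)) (genericPoint X)
    (((genericPoint_spec X).mem_open_set_iff U.isOpen).mpr (by simpa using ‹Nonempty U›))
    (scalars s ⊤ c)
  refine Eq.trans ?_ h
  change _ = X.germToFunctionField U _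
  congr 1
  change (X.presheaf.map (homOfLE (le_top : U ≤ ⊤)).op).hom _ =
    (X.presheaf.map (homOfLE (le_top : U ≤ ⊤)).op).hom ((X.presheaf.map _).hom _)
  rw [show (homOfLE (le_top : (⊤ : X.Opens) ≤ ⊤)).op = 𝟙 _ from rfl, X.presheaf.map_id]
  rfl

omit [IsIntegral X] in
lemma finiteType_scalars (s : X ⟶ Spec (.of k)) [LocallyOfFiniteType s] {U : X.Opens}
    (hU : IsAffineOpen U) : (scalars s U).FiniteType := by
  have h := s.finiteType_appLE (isAffineOpen_top _) hU le_top
  have h' : (Scheme.ΓSpecIso (.of k)).inv.hom.FiniteType :=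
    RingHom.FiniteType.of_surjective _
      (Scheme.ΓSpecIso (.of k)).commRingCatIsoToRingEquiv.symm.surjective
  exact h.comp h'

lemma krullDimLE_one_of_topologicalKrullDim_eq (hdim : topologicalKrullDim X' = 1) {U : X'.Opens}
    (hU : IsAffineOpen U) : Ring.KrullDimLE 1 Γ(X', U) := by
  rw [Ring.KrullDimLE, Order.krullDimLE_iff, ← ringKrullDim, Nat.cast_one,
    ← PrimeSpectrum.topologicalKrullDim_eq_ringKrullDim Γ(X', U)]
  change topologicalKrullDim (Spec Γ(X', U)) ≤ 1
  rw [← IsHomeomorph.topologicalKrullDim_eq _ hU.isoSpec.hom.homeomorph.isHomeomorph]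
  exact (topologicalKrullDim_subspace_le X' U).trans hdim.le

/-- An affine neighbourhood of `y` whose coordinate ring has dimension at most one. -/
lemma exists_affine_dimensionLEOne [IsIntegral X'] (hdim : topologicalKrullDim X' = 1)
    (π : X ⟶ X') [IsIntegralHom π] (y : X) :
    ∃ U : X.Opens, y ∈ U ∧ IsAffineOpen U ∧ Ring.DimensionLEOne Γ(X, U) := by
  obtain ⟨_, ⟨U, hU, rfl⟩, hyU, -⟩ :=
    X'.isBasis_affineOpens.exists_subset_of_mem_open (Set.mem_univ (π y)) isOpen_univ
  refine ⟨π ⁻¹ᵁ U, hyU, hU.preimage π, ?_⟩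
  have : Nonempty U := ⟨⟨_, hyU⟩⟩
  have : Nonempty (π ⁻¹ᵁ U) := ⟨⟨_, hyU⟩⟩
  have := krullDimLE_one_of_topologicalKrullDim_eq hdim hU
  have : Ring.DimensionLEOne Γ(X', U) := dimensionLEOne_of_krullDimLE
  have hint := π.isIntegral_app U hU
  algebraize [(π.app U).hom]
  have : Algebra.IsIntegral Γ(X', U) Γ(X, π ⁻¹ᵁ U) := ⟨hint⟩
  exact Ring.DimensionLEOne.of_isIntegral Γ(X', U) Γ(X, π ⁻¹ᵁ U)

/-- The `k`-algebra of sections over an open subset. -/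
abbrev sectionsAlgebra (s : X ⟶ Spec (.of k)) (U : X.Opens) : Algebra k Γ(X, U) :=
  (scalars s U).toAlgebra

lemma exists_isSeparable_functionField [IsAlgClosed k] (s : X ⟶ Spec (.of k))
    [LocallyOfFiniteType s] {U : X.Opens} [Nonempty U] (hU : IsAffineOpen U)
    [Ring.DimensionLEOne Γ(X, U)] :
    ∃ x : FunctionField s, Algebra.IsSeparable (IntermediateField.adjoin k {x})
      (FunctionField s) := by
  let := sectionsAlgebra s U
  have : Algebra.FiniteType k Γ(X, U) := finiteType_scalars s hU
  let : Algebra Γ(X, U) (FunctionField s) := inferInstanceAs (Algebra Γ(X, U) X.functionField)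
  have : IsFractionRing Γ(X, U) (FunctionField s) :=
    functionField_isFractionRing_of_isAffineOpen X U hU
  have : IsScalarTower k Γ(X, U) (FunctionField s) :=
    IsScalarTower.of_algebraMap_eq fun c => (algebraMap_scalars s U c).symm
  exact exists_isSeparable_adjoin_simple k Γ(X, U) (FunctionField s)

instance (s : X ⟶ Spec (.of k)) (y : X) :
    IsFractionRing (X.presheaf.stalk y) (FunctionField s) :=
  inferInstanceAs (IsFractionRing (X.presheaf.stalk y) X.functionField)

lemma isDiscreteValuationRing_stalk (s : X ⟶ Spec (.of k))
    [LocallyOfFiniteType s] {U : X.Opens} (hU : IsAffineOpen U)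
    [Ring.DimensionLEOne Γ(X, U)] {y : X} (hy : y ∈ U)
    [IsIntegrallyClosed (X.presheaf.stalk y)] {t : X.presheaf.stalk y} (ht : Irreducible t) :
    IsDiscreteValuationRing (X.presheaf.stalk y) := by
  have : Nonempty U := ⟨⟨y, hy⟩⟩
  let := sectionsAlgebra s U
  have : Algebra.FiniteType k Γ(X, U) := finiteType_scalars s hU
  have : IsNoetherianRing Γ(X, U) := Algebra.FiniteType.isNoetherianRing k _
  let := X.presheaf.algebra_section_stalk (⟨y, hy⟩ : U)
  have := hU.isLocalization_stalk ⟨y, hy⟩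
  exact isDiscreteValuationRing_of_localization (hU.primeIdealOf ⟨y, hy⟩).asIdeal ht

lemma exists_eq_add_mul_stalk [IsAlgClosed k] (s : X ⟶ Spec (.of k))
    [LocallyOfFiniteType s] {U : X.Opens} (hU : IsAffineOpen U)
    [Ring.DimensionLEOne Γ(X, U)] {y : X} (hy : y ∈ U)
    [IsDiscreteValuationRing (X.presheaf.stalk y)] {t : X.presheaf.stalk y} (ht : Irreducible t)
    (r : X.presheaf.stalk y) :
    ∃ (c : k) (r' : X.presheaf.stalk y), algebraMap _ (FunctionField s) r =
      algebraMap k (FunctionField s) c + algebraMap _ (FunctionField s) t *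
        algebraMap _ (FunctionField s) r' := by
  have : Nonempty U := ⟨⟨y, hy⟩⟩
  let := sectionsAlgebra s U
  have : Algebra.FiniteType k Γ(X, U) := finiteType_scalars s hU
  let := X.presheaf.algebra_section_stalk (⟨y, hy⟩ : U)
  have := hU.isLocalization_stalk ⟨y, hy⟩
  let : Algebra k (X.presheaf.stalk y) :=
    ((algebraMap Γ(X, U) (X.presheaf.stalk y)).comp (algebraMap k Γ(X, U))).toAlgebra
  have : IsScalarTower k Γ(X, U) (X.presheaf.stalk y) := IsScalarTower.of_algebraMap_eq' rfl
  let P := (hU.primeIdealOf ⟨y, hy⟩).asIdeal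
  have hP : P.IsMaximal := by
    refine (inferInstance : P.IsPrime).isMaximal fun hP => ?_
    refine IsDiscreteValuationRing.not_a_field (X.presheaf.stalk y) ?_
    rw [← IsLocalization.AtPrime.map_eq_maximalIdeal P, hP, Ideal.map_bot]
  obtain ⟨c, hc⟩ := exists_sub_mem_maximalIdeal (k := k) P r
  rw [ht.maximalIdeal_eq, Ideal.mem_span_singleton] at hc
  obtain ⟨r', hr'⟩ := hc
  refine ⟨c, r', ?_⟩
  rw [← map_mul, ← hr', map_sub]
  have : algebraMap k (FunctionField s) c = algebraMap _ (FunctionField s)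
      (algebraMap k (X.presheaf.stalk y) c) := by
    rw [← algebraMap_scalars s U]
    exact (X.algebraMap_germ_eq_germToFunctionField hy (scalars s U c)).symm
  rw [this]
  ring

variable (s : X' ⟶ Spec (.of k)) (π : X ⟶ X')

/-- The Cartier operator preserves the residue up to Frobenius, at every point of the curve. -/
lemma residue_cartier [IsAlgClosed k] (p : ℕ) [Fact p.Prime] [CharP k p] [IsIntegral X']
    (hdim : topologicalKrullDim X' = 1) [LocallyOfFiniteType (π ≫ s)] [IsNormalization π]
    (y : X) (ω : Ω[FunctionField (π ≫ s)⁄k]) :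
    residue k (X.presheaf.stalk y) (FunctionField (π ≫ s)) (cartier p ω) ^ p =
      residue k (X.presheaf.stalk y) (FunctionField (π ≫ s)) ω := by
  have hp : p.Prime := Fact.out
  unfold residue
  split_ifs with h
  swap
  · simp [hp.ne_zero]
  have ht := h.choose_spec
  set t := h.choose
  unfold residueAlong
  split_ifs with hρ
  swap
  · simp [hp.ne_zero]
  obtain ⟨U, hy, hU, hdimU⟩ := exists_affine_dimensionLEOne hdim π y
  have : Nonempty U := ⟨⟨y, hy⟩⟩
  have : IsIntegrallyClosed (X.presheaf.stalk y) := IsNormalization.normal π y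
  have : IsDiscreteValuationRing (X.presheaf.stalk y) :=
    isDiscreteValuationRing_stalk (π ≫ s) hU hy ht
  have : CharP (FunctionField (π ≫ s)) p := charP_of_injective_algebraMap
    (algebraMap k (FunctionField (π ≫ s))).injective p
  obtain ⟨x, hx⟩ := exists_isSeparable_functionField (π ≫ s) hU
  have hk : ∀ a : k, ∃ b, b ^ p = a := fun a => IsAlgClosed.exists_pow_nat_eq a hp.pos
  have hpow := not_pow_eq_algebraMap ht hp.one_lt (K := FunctionField (π ≫ s))
  obtain ⟨B⟩ := nonempty_pBasis p hk hpow (adjoin_frobenius_eq_top p hk x hpow)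
  exact residue_cartier_of_spec ht B (exists_eq_add_mul_stalk (π ≫ s) hU hy ht) _ hρ.choose_spec ω

/-- The Cartier operator is `p⁻¹`-linear. -/
lemma cartier_pow_smul [IsAlgClosed k] (p : ℕ) [Fact p.Prime] [CharP k p] [IsIntegral X']
    (hdim : topologicalKrullDim X' = 1) [LocallyOfFiniteType (π ≫ s)] [IsNormalization π]
    (f : FunctionField (π ≫ s)) (ω : Ω[FunctionField (π ≫ s)⁄k]) :
    cartier p (f ^ p • ω) = f • cartier p ω := by
  have hp : p.Prime := Fact.out
  have : CharP (FunctionField (π ≫ s)) p := charP_of_injective_algebraMap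
    (algebraMap k (FunctionField (π ≫ s))).injective p
  obtain ⟨U, hy, hU, hdimU⟩ := exists_affine_dimensionLEOne hdim π (genericPoint X)
  have : Nonempty U := ⟨⟨_, hy⟩⟩
  obtain ⟨x, hx⟩ := exists_isSeparable_functionField (π ≫ s) hU
  have hk : ∀ a : k, ∃ b, b ^ p = a := fun a => IsAlgClosed.exists_pow_nat_eq a hp.pos
  by_cases h : ∃ t : FunctionField (π ≫ s), ∀ b, b ^ p ≠ t
  · obtain ⟨t, ht⟩ := h
    obtain ⟨B⟩ := nonempty_pBasis p hk ht (adjoin_frobenius_eq_top p hk x ht)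
    exact B.cartier_pow_smul f ω
  · -- if `K = K ^ p` then every derivation of `K` vanishes
    push Not at h
    have hD : ∀ x : FunctionField (π ≫ s), D k (FunctionField (π ≫ s)) x = 0 := fun x => by
      obtain ⟨b, rfl⟩ := h x
      exact derivation_pow_char p _ b
    have h0 : ∀ ω : Ω[FunctionField (π ≫ s)⁄k], ω = 0 := fun ω => by
      have hω : ω ∈ Submodule.span (FunctionField (π ≫ s))
          (Set.range (D k (FunctionField (π ≫ s)))) := by
        rw [span_range_derivation]; trivial
      have : Set.range (D k (FunctionField (π ≫ s))) ⊆ {0} := by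
        rintro _ ⟨x, rfl⟩
        exact hD x
      simpa using Submodule.span_mono this hω
    rw [h0 (cartier p _), h0 (f • _)]

/-- `C` commutes with the sum of residues over a fibre, up to Frobenius. -/
lemma fibreResidue_cartier [IsAlgClosed k] (p : ℕ) [Fact p.Prime] [CharP k p] [IsIntegral X']
    (hdim : topologicalKrullDim X' = 1) [LocallyOfFiniteType (π ≫ s)] [IsNormalization π]
    (x : X') (ω : Ω[FunctionField (π ≫ s)⁄k]) :
    fibreResidue s π x (cartier p ω) ^ p = fibreResidue s π x ω := by
  have hp : p.Prime := Fact.out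
  let P : (Ω[FunctionField (π ≫ s)⁄k] →ₗ[k] k) → Prop := fun ρ => ∀ ω, ρ (cartier p ω) ^ p = ρ ω
  have h0 : P 0 := fun ω => by simp [hp.ne_zero]
  have hadd : ∀ ρ σ, P ρ → P σ → P (ρ + σ) := fun ρ σ hρ hσ ω => by
    rw [LinearMap.add_apply, LinearMap.add_apply, add_pow_char, hρ, hσ]
  have : P (fibreResidue s π x) :=
    finsum_induction P h0 hadd fun y => finsum_induction P h0 hadd fun _ =>
      residue_cartier s π p hdim y
  exact this ω

lemma cartier_mem_regularAt [IsAlgClosed k] (p : ℕ) [Fact p.Prime] [CharP k p] [IsIntegral X']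
    (hdim : topologicalKrullDim X' = 1) [LocallyOfFiniteType (π ≫ s)] [IsNormalization π]
    (x : X') {ω : Ω[FunctionField (π ≫ s)⁄k]} (hω : ω ∈ regularAt s π x) :
    cartier p ω ∈ regularAt s π x := fun f => by
  have hp : p.Prime := Fact.out
  rw [← pow_eq_zero_iff hp.ne_zero, ← cartier_pow_smul s π p hdim,
    fibreResidue_cartier s π p hdim, ← map_pow]
  exact hω (f ^ p)

end Curve

/-! ### First cohomology of subsheaves of constant sheaves -/

section Cohomology

variable {X : TopCat.{u}}

/-- Flasque sheaves of abelian groups have no first cohomology. -/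
lemma subsingleton_H_one_of_isFlasque (F : Sheaf (Opens.grothendieckTopology X) AddCommGrpCat.{u})
    [TopCat.Presheaf.IsFlasque F.obj] : Subsingleton (F.H 1) := by
  let S : ShortComplex (Sheaf (Opens.grothendieckTopology X) AddCommGrpCat.{u}) :=
    ShortComplex.mk (Injective.ι F) (Limits.cokernel.π _) (Limits.cokernel.condition _)
  have hS : S.ShortExact :=
    { exact := ShortComplex.exact_cokernel _
      mono_f := inferInstanceAs (Mono (Injective.ι F))
      epi_g := inferInstanceAs (Epi (Limits.cokernel.π _)) }
  have : Injective S.X₂ := inferInstanceAs (Injective (Injective.under F))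
  refine subsingleton_of_forall_eq 0 fun v => ?_
  obtain ⟨q, hq⟩ := Abelian.Ext.covariant_sequence_exact₁ _ hS (v : S.X₁.H 1)
    (Subsingleton.elim (α := S.X₂.H (0 + 1)) _ _) (zero_add 1)
  have hepi : Epi (S.g.hom.app (op ⊤)) :=
    TopCat.Sheaf.IsFlasque.epi_of_shortExact (X := X) (U := ⊤) (S := S) hS
  obtain ⟨b, hb⟩ := (AddCommGrpCat.epi_iff_surjective _).mp hepi
    (Sheaf.H.equiv₀ S.X₃ Limits.isTerminalTop q)
  have hq' : q = Sheaf.H.map S.g 0 ((Sheaf.H.equiv₀ S.X₂ Limits.isTerminalTop).symm b) := by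
    rw [Sheaf.H.equiv₀_symm_naturality, hb, AddEquiv.symm_apply_apply]
  rw [← hq, hq', Sheaf.H.map_apply, Abelian.Ext.comp_assoc_of_second_deg_zero,
    hS.comp_extClass, Abelian.Ext.comp_zero]

/-- On an irreducible space every section of a constant sheaf is constant. -/
lemma exists_eq_const [PreirreducibleSpace X] {M : Type u} [AddCommGroup M]
    {L : X → AddSubgroup M} {U : Opens X} (s : constSections L U) :
    ∃ m : M, ∀ x : U, s.1 x = m := by
  by_cases hU : Nonempty U
  swap
  · exact ⟨0, fun x => absurd ⟨x⟩ hU⟩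
  obtain ⟨x₀⟩ := hU
  refine ⟨s.1 x₀, fun x => ?_⟩
  obtain ⟨V, hV, i, m, hm⟩ := s.2 x
  obtain ⟨V₀, hV₀, i₀, m₀, hm₀⟩ := s.2 x₀
  obtain ⟨y, hy, hy₀⟩ := nonempty_preirreducible_inter V.2 V₀.2 ⟨x, hV⟩ ⟨x₀, hV₀⟩
  have h1 := (hm ⟨x, hV⟩).1.trans (hm ⟨y, hy⟩).1.symm
  have h2 := (hm₀ ⟨x₀, hV₀⟩).1.trans (hm₀ ⟨y, hy₀⟩).1.symm
  exact h1.trans h2.symm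

instance isFlasque_constSheaf_top [PreirreducibleSpace X] {M : Type u} [AddCommGroup M] :
    TopCat.Presheaf.IsFlasque (constSheaf (fun _ : X => (⊤ : AddSubgroup M))).obj where
  epi {U V} i := by
    rw [AddCommGrpCat.epi_iff_surjective]
    intro s
    obtain ⟨m, hm⟩ := exists_eq_const (U := V.unop) (s : constSections _ V.unop)
    exact ⟨constSection U.unop m, Subtype.ext (funext fun x => (hm x).symm)⟩

/-- The map of constant sheaves induced by an additive map. -/
def constSheafMap {M N : Type u} [AddCommGroup M] [AddCommGroup N] (φ : M →+ N) :
    constSheaf (fun _ : X => (⊤ : AddSubgroup M)) ⟶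
      constSheaf (fun _ : X => (⊤ : AddSubgroup N)) where
  hom :=
    { app := fun U => AddCommGrpCat.ofHom
        { toFun := fun s => ⟨fun x => φ (s.1 x), fun x => by
            obtain ⟨V, hV, i, m, hm⟩ := s.2 x
            exact ⟨V, hV, i, φ m, fun y => ⟨congrArg φ (hm y).1, trivial⟩⟩⟩
          map_zero' := Subtype.ext (funext fun _ => φ.map_zero)
          map_add' := fun _ _ => Subtype.ext (funext fun _ => φ.map_add _ _) } }

variable {F : Sheaf (Opens.grothendieckTopology X) AddCommGrpCat.{u}} {M : Type u} [AddCommGroup M]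
  (ι : F ⟶ constSheaf (fun _ : X => (⊤ : AddSubgroup M))) [Mono ι]

/-- The exact sequence `0 → F → M → M/F → 0` for a subsheaf `F` of a constant sheaf. -/
def cokernelSequence : ShortComplex (Sheaf (Opens.grothendieckTopology X) AddCommGrpCat.{u}) :=
  ShortComplex.mk ι (Limits.cokernel.π ι) (Limits.cokernel.condition ι)

lemma cokernelSequence_shortExact : (cokernelSequence ι).ShortExact where
  exact := ShortComplex.exact_cokernel _
  mono_f := inferInstanceAs (Mono ι)
  epi_g := inferInstanceAs (Epi (Limits.cokernel.π ι))

/-- Every class in `H¹(X, F)` is the coboundary of a section of `M/F`. -/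
lemma exists_comp_extClass_eq [PreirreducibleSpace X] (v : F.H 1) :
    ∃ σ : (cokernelSequence ι).X₃.obj.obj (op ⊤),
      ((Sheaf.H.equiv₀ (cokernelSequence ι).X₃ Limits.isTerminalTop).symm σ).comp
        (cokernelSequence_shortExact ι).extClass (zero_add 1) = v := by
  have : Subsingleton ((cokernelSequence ι).X₂.H 1) :=
    subsingleton_H_one_of_isFlasque (constSheaf (fun _ : X => (⊤ : AddSubgroup M)))
  obtain ⟨q, hq⟩ := Abelian.Ext.covariant_sequence_exact₁ _ (cokernelSequence_shortExact ι) v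
    (Subsingleton.elim (α := (cokernelSequence ι).X₂.H 1) _ _) (zero_add 1)
  exact ⟨Sheaf.H.equiv₀ (cokernelSequence ι).X₃ Limits.isTerminalTop q, by
    rw [AddEquiv.symm_apply_apply, hq]⟩

omit [Mono ι] in
/-- Locally a section of `M/F` is the class of a constant. -/
lemma exists_local_representative (σ : (cokernelSequence ι).X₃.obj.obj (op ⊤)) (x : X) :
    ∃ (m : M) (U : Opens X), x ∈ U ∧
      (cokernelSequence ι).X₃.obj.map (homOfLE (le_top : U ≤ ⊤)).op σ =
        (cokernelSequence ι).g.hom.app (op U) (constSection U m) := by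
  have hepi : Epi (cokernelSequence ι).g := inferInstanceAs (Epi (Limits.cokernel.π ι))
  have hloc := (TopCat.Sheaf.isLocallySurjective_iff_epi (X := X) (cokernelSequence ι).g).mpr hepi
  obtain ⟨V, hV, ⟨t, ht⟩, hxV⟩ :=
    (TopCat.Presheaf.isLocallySurjective_iff (cokernelSequence ι).g.hom).mp hloc ⊤ σ x trivial
  obtain ⟨W, hxW, i, m, hm⟩ := (t : constSections _ V).2 ⟨x, hxV⟩
  refine ⟨m, W, hxW, ?_⟩
  have ht' : (constSheaf (fun _ : X => (⊤ : AddSubgroup M))).obj.map i.op t = constSection W m :=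
    Subtype.ext (funext fun y => (hm y).1)
  rw [← ht']
  have := ConcreteCategory.congr_hom ((cokernelSequence ι).g.hom.naturality i.op) t
  refine Eq.trans ?_ this.symm
  change _ = (cokernelSequence ι).X₃.obj.map i.op ((cokernelSequence ι).g.hom.app (op V) t)
  rw [ht]
  exact ConcreteCategory.congr_hom ((cokernelSequence ι).X₃.obj.map_comp
    (homOfLE (le_top : V ≤ ⊤)).op i.op) σ

variable {N : Type u} [AddCommGroup N] {L : X → AddSubgroup N}

/-- The connecting homomorphism is natural. -/
lemma map_comp_extClass {S₁ S₂ : ShortComplex (Sheaf (Opens.grothendieckTopology X)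
    AddCommGrpCat.{u})} (h₁ : S₁.ShortExact) (h₂ : S₂.ShortExact) (Φ : S₁ ⟶ S₂)
    (σ : S₁.X₃.obj.obj (op ⊤)) :
    Sheaf.H.map Φ.τ₁ 1 (((Sheaf.H.equiv₀ S₁.X₃ Limits.isTerminalTop).symm σ).comp
      h₁.extClass (zero_add 1)) =
    ((Sheaf.H.equiv₀ S₂.X₃ Limits.isTerminalTop).symm (Φ.τ₃.hom.app (op ⊤) σ)).comp
      h₂.extClass (zero_add 1) := by
  rw [← Sheaf.H.equiv₀_symm_naturality, Sheaf.H.map_apply, Sheaf.H.map_apply,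
    Abelian.Ext.comp_assoc_of_second_deg_zero, Abelian.Ext.comp_assoc_of_third_deg_zero,
    ShortComplex.ShortExact.extClass_naturality h₁ h₂ Φ]

/-- A morphism of sheaves `F → 𝓛` which extends to the constant sheaf `M` is computed on `H¹` by
local representatives. -/
lemma exists_connecting_eq (φ : M →+ N) (τ : F ⟶ constSheaf L)
    (h : ι ≫ constSheafMap φ = τ ≫ constSheafIncl (fun _ => le_top))
    {v : F.H 1} {σ : (cokernelSequence ι).X₃.obj.obj (op ⊤)}
    (hσ : ((Sheaf.H.equiv₀ (cokernelSequence ι).X₃ Limits.isTerminalTop).symm σ).comp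
      (cokernelSequence_shortExact ι).extClass (zero_add 1) = v) {r : X → M}
    (hr : ∀ x, ∃ U : Opens X, x ∈ U ∧
      (cokernelSequence ι).X₃.obj.map (homOfLE (le_top : U ≤ ⊤)).op σ =
        (cokernelSequence ι).g.hom.app (op U) (constSection U (r x))) :
    ∃ σ' : (quotientSequence L).X₃.obj.obj (op ⊤),
      Represents L σ' (fun x => φ (r x)) ∧
      Sheaf.H.map τ 1 v = connecting L σ' := by
  subst hσ
  let Φ : cokernelSequence ι ⟶ quotientSequence L :=
    { τ₁ := τ
      τ₂ := constSheafMap φ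
      τ₃ := Limits.cokernel.map _ _ τ (constSheafMap φ) h
      comm₁₂ := h.symm
      comm₂₃ := (Limits.cokernel.π_desc _ _ _).symm }
  refine ⟨Φ.τ₃.hom.app (op ⊤) σ, fun x => ?_, ?_⟩
  · obtain ⟨U, hxU, hU⟩ := hr x
    refine ⟨U, hxU, ?_⟩
    have h1 := ConcreteCategory.congr_hom (Φ.τ₃.hom.naturality (homOfLE (le_top : U ≤ ⊤)).op) σ
    have h2 := ConcreteCategory.congr_hom
      (congrArg (fun f => f.hom.app (op U)) Φ.comm₂₃) (constSection U (r x))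
    refine h1.symm.trans ?_
    refine Eq.trans ?_ h2.symm
    exact congrArg (Φ.τ₃.hom.app (op U)) hU
  · exact map_comp_extClass (cokernelSequence_shortExact ι) (quotientSequence_shortExact L) Φ σ

end Cohomology

/-! ### The duality pairing -/

section Pairing

variable {k : Type u} [Field k] {X X' : Scheme.{u}} [IsIntegral X]
  (s : X' ⟶ Spec (.of k)) (π : X ⟶ X') [IsDominant π]

/-- The local rings of `X'` are subrings of the function field of `X`. -/
lemma stalkPullback_injective [IsReduced X'] (x : X') :
    Function.Injective (stalkPullback s π x) := by
  rw [injective_iff_map_eq_zero]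
  intro f hf
  obtain ⟨U, hx, a, rfl⟩ := X'.presheaf.exists_germ_eq f
  rw [stalkPullback_germ] at hf
  -- a non-zero section is invertible on a non-empty open set, which contains the image of the
  -- generic point
  suffices h : a = 0 by rw [h, map_zero]
  by_contra ha
  have hne : X'.basicOpen a ≠ ⊥ := fun h => ha ((basicOpen_eq_bot_iff a).mp h)
  obtain ⟨z, hz⟩ := (Opens.ne_bot_iff_nonempty _).mp hne
  have hgen : π (genericPoint X) ∈ X'.basicOpen a :=
    (specializes_of_isDominant π z).mem_open (X'.basicOpen a).2 hz
  have hunit := (X'.mem_basicOpen a _ (X'.basicOpen_le a hgen)).mp hgen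
  exact (hunit.map (π.stalkMap (genericPoint X)).hom).ne_zero hf

/-- The inclusion of the structure sheaf of `X'` into the constant sheaf of rational functions
on `X`. -/
def functionInclusion :
    structureSheafAb X' ⟶
      constSheaf (fun _ : X'.toTopCat => (⊤ : AddSubgroup (FunctionField (π ≫ s)))) where
  hom :=
    { app := fun U => AddCommGrpCat.ofHom
        { toFun := fun f => ⟨fun x => stalkPullback s π x.1
              (X'.presheaf.germ U.unop x.1 x.2 (f : Γ(X', U.unop))), fun x =>
            ⟨U.unop, x.2, 𝟙 _, stalkPullback s π x.1
              (X'.presheaf.germ U.unop x.1 x.2 (f : Γ(X', U.unop))), fun y => by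
                refine ⟨?_, trivial⟩
                change stalkPullback s π y.1 (X'.presheaf.germ U.unop y.1 y.2 (f : Γ(X', U.unop))) =
                  _
                rw [stalkPullback_germ, stalkPullback_germ]⟩⟩
          map_zero' := Subtype.ext <| funext fun x => by
            change stalkPullback s π x.1
              (X'.presheaf.germ U.unop x.1 x.2 (0 : Γ(X', U.unop))) = 0
            rw [map_zero, map_zero]
          map_add' := fun f g => Subtype.ext <| funext fun x => by
            change stalkPullback s π x.1 (X'.presheaf.germ U.unop x.1 x.2
                ((f : Γ(X', U.unop)) + (g : Γ(X', U.unop)))) =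
              stalkPullback s π x.1 (X'.presheaf.germ U.unop x.1 x.2 (f : Γ(X', U.unop))) +
              stalkPullback s π x.1 (X'.presheaf.germ U.unop x.1 x.2 (g : Γ(X', U.unop)))
            rw [map_add, map_add] }
      naturality := fun U V i => by
        ext f
        refine Subtype.ext <| funext fun x => ?_
        change stalkPullback s π x.1 (X'.presheaf.germ V.unop x.1 x.2
            (X'.presheaf.map i (f : Γ(X', U.unop)))) =
          stalkPullback s π x.1 (X'.presheaf.germ U.unop x.1 (i.unop.le x.2)
            (f : Γ(X', U.unop)))
        congr 1
        exact X'.presheaf.germ_res_apply i.unop x.1 x.2 (f : Γ(X', U.unop)) }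

instance mono_functionInclusion [IsReduced X'] : Mono (functionInclusion s π) := by
  have : ∀ U, Mono ((functionInclusion s π).hom.app U) := fun U => by
    rw [AddCommGrpCat.mono_iff_injective]
    intro a b hab
    refine TopCat.Presheaf.section_ext X'.sheaf _ _ _ fun x hx => ?_
    exact stalkPullback_injective s π x (congrFun (congrArg Subtype.val hab :) ⟨x, hx⟩)
  have : Mono (functionInclusion s π).hom := NatTrans.mono_of_mono_app _
  exact Sheaf.Hom.mono_of_presheaf_mono _ _ _

/-- Multiplication of rational functions by a fixed form. -/
def mulRational (ω : Ω[FunctionField (π ≫ s)⁄k]) :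
    FunctionField (π ≫ s) →+ Ω[FunctionField (π ≫ s)⁄k] :=
  (LinearMap.toSpanSingleton (FunctionField (π ≫ s)) _ ω).toAddMonoidHom

lemma functionInclusion_mulForm (ω : regularDifferentials s π) :
    functionInclusion s π ≫ constSheafMap (mulRational s π ω.1) =
      mulForm s π ω ≫ constSheafIncl (L := regularStalk s π) (fun _ => le_top) := by
  ext U f
  rfl

lemma functionInclusion_frobeniusSheaf_mulForm (p : ℕ) [Fact p.Prime] [CharP k p]
    [CharP (FunctionField (π ≫ s)) p] (ω : regularDifferentials s π) :
    functionInclusion s π ≫ constSheafMap ((mulRational s π ω.1).comp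
        (_root_.frobenius (FunctionField (π ≫ s)) p).toAddMonoidHom) =
      (frobeniusSheaf s p ≫ mulForm s π ω) ≫
        constSheafIncl (L := regularStalk s π) (fun _ => le_top) := by
  ext U f
  refine Subtype.ext <| funext fun x => ?_
  have h : ∀ g : Γ(X', U.unop),
      stalkPullback s π x.1 (X'.presheaf.germ U.unop x.1 x.2 g) ^ p • ω.1 =
      stalkPullback s π x.1 (X'.presheaf.germ U.unop x.1 x.2 (g ^ p)) • ω.1 := fun g => by
    rw [map_pow, map_pow]
  exact h f

end Pairing

/-- The pairing formula for any functional `T` on `H¹(X', Ω_{X'})` that is computed by sums of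
residues. The class `v` is the coboundary of a section of `K / 𝒪_{X'}` with local representatives
`r x`, so that `F v · ω` and `v · C ω` have the local representatives `(r x) ^ p ω` and
`r x · C ω = C ((r x) ^ p ω)`. -/
lemma residueMap_frobenius {k : Type u} [Field k] [IsAlgClosed k] (p : ℕ) [Fact p.Prime]
    [CharP k p] {X X' : Scheme.{u}} [IsIntegral X] [IsIntegral X'] (s : X' ⟶ Spec (.of k))
    (hdim : topologicalKrullDim X' = 1) (π : X ⟶ X') [LocallyOfFiniteType (π ≫ s)]
    [IsNormalization π] (T : (regularSheaf s π).H 1 →+ k)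
    (hT : ∀ σ r, Represents (regularStalk s π) σ r →
      T (connecting (regularStalk s π) σ) = ∑ᶠ x : X', fibreResidue s π x (r x))
    (ω η : regularDifferentials s π) (hη : η.1 = cartier p ω.1) (v : (structureSheafAb X').H 1) :
    T (cup s π (frobenius s p v) ω) = T (cup s π v η) ^ p := by
  have : CharP (FunctionField (π ≫ s)) p := charP_of_injective_algebraMap
    (algebraMap k (FunctionField (π ≫ s))).injective p
  obtain ⟨σ, hσ⟩ := exists_comp_extClass_eq (functionInclusion s π) v
  choose r hr using exists_local_representative (functionInclusion s π) σ
  obtain ⟨σ₁, hσ₁, h₁⟩ := exists_connecting_eq (functionInclusion s π) _ _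
    (functionInclusion_frobeniusSheaf_mulForm s π p ω) hσ hr
  obtain ⟨σ₂, hσ₂, h₂⟩ := exists_connecting_eq (functionInclusion s π) _ _
    (functionInclusion_mulForm s π η) hσ hr
  have h₁' : cup s π (frobenius s p v) ω = connecting (regularStalk s π) σ₁ :=
    (Sheaf.H.map_comp_apply (frobeniusSheaf s p) (mulForm s π ω) v).symm.trans h₁
  have h₂' : cup s π v η = connecting (regularStalk s π) σ₂ := h₂
  rw [h₁', h₂', hT _ _ hσ₁, hT _ _ hσ₂]
  have hinj : Function.Injective (_root_.frobenius k p).toAddMonoidHom := frobenius_inj k p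
  refine Eq.trans ?_ (AddMonoidHom.map_finsum_of_injective _ hinj _).symm
  refine finsum_congr fun x => ?_
  change fibreResidue s π x (r x ^ p • ω.1) = fibreResidue s π x (r x • η.1) ^ p
  rw [hη, ← cartier_pow_smul s π p hdim, fibreResidue_cartier s π p hdim]

end CartierRosenlicht
end

open CartierRosenlicht in
theorem lemma5 {k : Type u} [Field k] [IsAlgClosed k] (p : ℕ) [Fact p.Prime] [CharP k p]
    {X X' : Scheme.{u}} [IsIntegral X] [IsIntegral X']
    (s : X' ⟶ Spec (.of k)) [IsProper s] (hdim : topologicalKrullDim X' = 1)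
    (π : X ⟶ X') [IsProper (π ≫ s)] [IsNormalization π] :
    ∃ hC : ∀ ω ∈ regularDifferentials s π, cartier p ω ∈ regularDifferentials s π,
      ∀ (v : (structureSheafAb X').H 1) (ω : regularDifferentials s π),
        pairing s π (frobenius s p v) ω =
          pairing s π v ⟨cartier p ω.1, hC ω.1 ω.2⟩ ^ p := by
  have hC : ∀ ω ∈ regularDifferentials s π, cartier p ω ∈ regularDifferentials s π :=
    fun ω hω => (Submodule.mem_iInf _).mpr fun x =>
      cartier_mem_regularAt s π p hdim x ((Submodule.mem_iInf _).mp hω x)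
  refine ⟨hC, fun v ω => ?_⟩
  unfold pairing residueMap
  split_ifs with h
  · exact residueMap_frobenius p s hdim π _ h.choose_spec ω _ rfl v
  · -- without a functional computed by sums of residues both sides would be `0`; by the residue
    -- theorem this case does not arise
    simp [(Fact.out : p.Prime).ne_zero]
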